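/- Let $(\Omega,\mathcal A,\mathbb P)$ be a probability space, let $\mathbb S^2\subset\mathbb R^3$ be the unit sphere with geodesic distance $d(x,y)=\arccos\langle x,y\rangle$ and surface measure $\sigma$, and let $Y_{\ell m}$ ($\ell\in\mathbb N_0$, $-\ell\le m\le \ell$) be the orthonormal complex spherical harmonics, $$Y_{\ell m}(\vartheta,\varphi)=\sqrt{\tfrac{2\ell+1}{4\pi}\tfrac{(\ell-m)!}{(\ell+m)!}}\,P_{\ell m}(\cos\vartheta)e^{im\varphi}\quad(m\ge 0),\qquad Y_{\ell m}=(-1)^m\overline{Y_{\ell,-m}}\quad(m<0),$$ with $P_{\ell m}(\mu)=(-1)^m(1-\mu^2)^{m/2}\frac{d^m}{d\mu^m}P_\ell(\mu)$ and $P_\ell$ the Legendre polynomials. A random field on $\mathbb S^2$ is an $\mathcal A\otimes\mathcal B(\mathbb S^2)$-measurable map $T:\Omega\times\mathbb S^2\to\mathbb R$. It is Gaussian if all its finite-dimensional distributions are (possibly degenerate) multivariate Gaussian. A Gaussian random field $T$ is called isotropic if $\mathbb E(T(x)^2)<\infty$, $\mathbb E(T(x))=\mathbb E(T(gx))$ and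 $\mathbb E(T(x)T(y))=\mathbb E(T(gx)T(gy))$ for all $x,y\in\mathbb S^2$ and $g\in SO(3)$. With $a_{\ell m}=\int_{\mathbb S^2}T(y)\overline{Y_{\ell m}(y)}\,d\sigma(y)$, the angular power spectrum of such a $T$ is the sequence $(A_\ell)_{\ell\in\mathbb N_0}$ of nonnegative reals with $\mathbb E(a_{\ell_1m_1}\overline{a_{\ell_2m_2}})=A_{\ell_1}\delta_{\ell_1\ell_2}\delta_{m_1m_2}$ for $\ell_1,\ell_2\ge1$ and $\mathbb E(a_{00}\overline{a_{\ell m}})=(A_0+\mathbb E(a_{00})^2)\delta_{0\ell}\delta_{0m}$ for all $\ell, m$. **Corollary.** Let $T$ be an isotropic Gaussian random field on $\mathbb S^2$ with angular power spectrum $(A_\ell)_{\ell\in\mathbb N_0}$. Suppose that $A_\ell\le C\,\ell^{-\alpha}$ for all $\ell\in\mathbb N$ with $\ell\ge 1$, for some $\alpha>2$ and some constant $C$. Then there exists a modification $S$ of $\exp(T)$, i.e. a random field $S$ on $\mathbb S^2$ with $\mathbb P(S(x)=\exp(T(x)))=1$ for every $x\in\mathbb S^2$, such that every sample path of $S$ is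 Hölder continuous with every exponent $\gamma$ satisfying $0<\gamma<(\alpha-2)/2$ and $\gamma\le1$: for each $\omega\in\Omega$ and each such $\gamma$ there is a finite constant $K$ with $|S(\omega,x)-S(\omega,y)|\le K\,d(x,y)^{\gamma}$ for all $x,y\in\mathbb S^2$. -/

import Mathlib

open MeasureTheory ProbabilityTheory

noncomputable section

/-- The unit sphere `𝕊²` in `ℝ³`. -/
abbrev Sphere2 : Type := Metric.sphere (0 : EuclideanSpace ℝ (Fin 3)) 1

/-- The geodesic distance `arccos ⟨x, y⟩` on `𝕊²`. -/
def geodesicDist (x y : Sphere2) : ℝ :=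
  Real.arccos (inner ℝ (x : EuclideanSpace ℝ (Fin 3)) (y : EuclideanSpace ℝ (Fin 3)))

/-- The Lebesgue (surface) measure `σ` on `𝕊²`, of total mass `4π`. -/
def sphereMeasure : Measure Sphere2 :=
  (volume : Measure (EuclideanSpace ℝ (Fin 3))).toSphere

/-- The action on `𝕊²` of a linear isometry of `ℝ³`. -/
def isometryAct (g : EuclideanSpace ℝ (Fin 3) ≃ₗᵢ[ℝ] EuclideanSpace ℝ (Fin 3))
    (x : Sphere2) : Sphere2 :=
  ⟨g x, by simp⟩

/-- `g` is a rotation, i.e. an element of `SO(3)`. -/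
def IsRotation (g : EuclideanSpace ℝ (Fin 3) ≃ₗᵢ[ℝ] EuclideanSpace ℝ (Fin 3)) : Prop :=
  LinearMap.det (g.toLinearEquiv : EuclideanSpace ℝ (Fin 3) →ₗ[ℝ] EuclideanSpace ℝ (Fin 3)) = 1

/-! Spherical harmonics -/

/-- The Legendre polynomial `P_ℓ`, by Rodrigues' formula. -/
def legendrePoly (l : ℕ) : Polynomial ℝ :=
  Polynomial.C ((2 : ℝ) ^ l * (l.factorial : ℝ))⁻¹ *
    Polynomial.derivative^[l] ((Polynomial.X ^ 2 - 1) ^ l)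

/-- The associated Legendre function `P_{ℓm}`, `0 ≤ m ≤ ℓ`,
`P_{ℓm}(μ) = (-1)^m (1 - μ²)^{m/2} (d/dμ)^m P_ℓ(μ)` for `μ ∈ [-1, 1]`. -/
def assocLegendre (l m : ℕ) (μ : ℝ) : ℝ :=
  (-1) ^ m * Real.sqrt (1 - μ ^ 2) ^ m * (Polynomial.derivative^[m] (legendrePoly l)).eval μ

/-- `Y_{ℓm}` in angular coordinates for `0 ≤ m ≤ ℓ`. -/
def sphHarmNat (l m : ℕ) (ϑ φ : ℝ) : ℂ :=
  ((Real.sqrt ((2 * l + 1) / (4 * Real.pi) *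
      (((l - m).factorial : ℝ) / ((l + m).factorial : ℝ))) *
      assocLegendre l m (Real.cos ϑ) : ℝ) : ℂ) *
    Complex.exp (Complex.I * m * φ)

/-- `Y_{ℓm}` in angular coordinates for `-ℓ ≤ m ≤ ℓ`, with
`Y_{ℓm} = (-1)^m conj Y_{ℓ,-m}` for `m < 0`. -/
def sphHarmAngular (l : ℕ) (m : ℤ) (ϑ φ : ℝ) : ℂ :=
  if 0 ≤ m then sphHarmNat l m.natAbs ϑ φ
  else (-1) ^ m.natAbs * (starRingEnd ℂ) (sphHarmNat l m.natAbs ϑ φ)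

/-- `Y_{ℓm}` as a function on `𝕊²`, where `y = (sin ϑ cos φ, sin ϑ sin φ, cos ϑ)`.
The azimuth `φ` is taken in `(-π, π]`, which is immaterial since `Y_{ℓm}` is `2π`-periodic in `φ`. -/
def sphHarm (l : ℕ) (m : ℤ) (y : Sphere2) : ℂ :=
  sphHarmAngular l m
    (Real.arccos ((y : EuclideanSpace ℝ (Fin 3)) 2))
    (Complex.arg ⟨(y : EuclideanSpace ℝ (Fin 3)) 0, (y : EuclideanSpace ℝ (Fin 3)) 1⟩)

/-! Random fields on the sphere -/

/-- A real-valued random field on `𝕊²` is a jointly measurable map `Ω × 𝕊² → ℝ`. -/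
def IsRandomField {Ω : Type*} [MeasurableSpace Ω] (T : Ω → Sphere2 → ℝ) : Prop :=
  Measurable (fun p : Ω × Sphere2 => T p.1 p.2)

/-- `n`-weak isotropy: finite moments of order `n`, and rotation invariance of all mixed moments
of order `1 ≤ k ≤ n`. -/
def IsWeaklyIsotropic {Ω : Type*} [MeasurableSpace Ω] (P : Measure Ω) (n : ℕ)
    (T : Ω → Sphere2 → ℝ) : Prop :=
  (∀ x : Sphere2, MemLp (fun ω => T ω x) n P) ∧
  ∀ k : ℕ, 1 ≤ k → k ≤ n → ∀ (x : Fin k → Sphere2)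
    (g : EuclideanSpace ℝ (Fin 3) ≃ₗᵢ[ℝ] EuclideanSpace ℝ (Fin 3)), IsRotation g →
      ∫ ω, ∏ i, T ω (x i) ∂P = ∫ ω, ∏ i, T ω (isometryAct g (x i)) ∂P

/-- An isotropic Gaussian random field on `𝕊²`: a `2`-weakly isotropic random field all of whose
finite-dimensional distributions are (possibly degenerate) multivariate Gaussian. -/
structure IsIsotropicGRF {Ω : Type*} [MeasurableSpace Ω] (P : Measure Ω)
    (T : Ω → Sphere2 → ℝ) : Prop where
  isRandomField : IsRandomField T
  isGaussian : IsGaussianProcess (fun (x : Sphere2) (ω : Ω) => T ω x) P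
  isWeaklyIsotropic : IsWeaklyIsotropic P 2 T

/-- The Karhunen–Loève coefficient `a_{ℓm} = ∫ T(y) conj(Y_{ℓm}(y)) dσ(y)`. -/
def klCoeff {Ω : Type*} (T : Ω → Sphere2 → ℝ) (l : ℕ) (m : ℤ) (ω : Ω) : ℂ :=
  ∫ y, (T ω y : ℂ) * (starRingEnd ℂ) (sphHarm l m y) ∂sphereMeasure

/-- `A` is the angular power spectrum of `T`: the sequence of nonnegative reals given by
`E(a_{ℓm} conj a_{ℓ'm'}) = A_ℓ δ_{ℓℓ'} δ_{mm'}` for `ℓ, ℓ' ≥ 1`, and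
`E(a_{00} conj a_{ℓm}) = (A_0 + E(a_{00})²) δ_{0ℓ} δ_{0m}`. -/
structure IsAngularPowerSpectrum {Ω : Type*} [MeasurableSpace Ω] (P : Measure Ω)
    (T : Ω → Sphere2 → ℝ) (A : ℕ → ℝ) : Prop where
  nonneg : ∀ l, 0 ≤ A l
  covariance : ∀ (l₁ l₂ : ℕ) (m₁ m₂ : ℤ), 1 ≤ l₁ → 1 ≤ l₂ → |m₁| ≤ l₁ → |m₂| ≤ l₂ →
    ∫ ω, klCoeff T l₁ m₁ ω * (starRingEnd ℂ) (klCoeff T l₂ m₂ ω) ∂P =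
      if l₁ = l₂ ∧ m₁ = m₂ then (A l₁ : ℂ) else 0
  covariance_zero : ∀ (l : ℕ) (m : ℤ), |m| ≤ l →
    ∫ ω, klCoeff T 0 0 ω * (starRingEnd ℂ) (klCoeff T l m ω) ∂P =
      if l = 0 ∧ m = 0 then (A 0 : ℂ) + (∫ ω, klCoeff T 0 0 ω ∂P) ^ 2 else 0

/-- `S` is a modification of `T`. -/
def IsModification {Ω : Type*} [MeasurableSpace Ω] (P : Measure Ω)
    (S T : Ω → Sphere2 → ℝ) : Prop :=
  IsRandomField S ∧ ∀ x : Sphere2, ∀ᵐ ω ∂P, S ω x = T ω x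

/-- `f` is Hölder continuous on `𝕊²` with exponent `γ` with respect to the geodesic distance. -/
def IsHoelderSphere (γ : ℝ) (f : Sphere2 → ℝ) : Prop :=
  ∃ K : ℝ, ∀ x y : Sphere2, |f x - f y| ≤ K * geodesicDist x y ^ γ

end

/-! The argument is a Littlewood–Paley decomposition. Let Δ_j T be the convolution of T with the
reproducing kernel of the degrees 2^j ≤ l < 2^(j+1), a zonal polynomial (`blockKernel`). Its second
moment at the north pole is the sum of (2l+1)/(4π) A_l over the block, read off from the
coefficients a_{l0}, and isotropy makes it the same at every point. The decay of A bounds it by C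
ρ^(2j) with ρ = 2^(-(α-2)/2).

Linear functionals of T are L² limits of Gaussian variables, so every moment is controlled by the
second (`IsIsotropicGRF.eLpNorm_integral_mul_le`). A Nikolskii inequality
(`exists_abs_zonalConv_pow_le`) bounds the supremum of a zonal convolution of degree N by its L^p
norm at the cost of a fixed power of N, which a large p absorbs. Hence for every r > ρ, almost
surely sup |Δ_j T| ≤ K r^j (`IsIsotropicGRF.ae_exists_abs_zonalConv_blockKernel_le`). By Bernstein's
inequality (`abs_zonalConv_sub_le`) Δ_j T also has Lipschitz constant of order 2^j r^j.
Interpolating between the two bounds, the series of the blocks is γ-Hölder as soon as 2^γ r < 1, and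
such an r > ρ exists exactly when γ < (α-2)/2. The exponential preserves this on a compact space.

It remains to see that the series equals T(x) almost surely for each x. Almost every path has the
same Legendre convolutions as its series, hence agrees with it σ-almost everywhere
(`ae_eq_zero_of_zonalConv_legendrePoly`). By Fubini some point z has T(z) equal to the series almost
surely, so the partial sums converge to T(z) in L². By isotropy the L² error does not depend on the
point, so they converge to T(x) in L² for every x, and the almost sure limit must be the same.

The facts on spherical harmonics are obtained from zonal polynomials alone: the convolution of two
is again one, and orthogonality of the Legendre polynomials on [-1, 1] then gives the reproducing
identities (`zonalConv_legendrePoly_self`, `zonalConv_legendrePoly_of_ne`). -/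

/-! ### Trigonometric polynomials and Bernstein's inequality on the circle -/

/-- `f` is a real trigonometric polynomial of degree at most `N`. -/
def IsTrigPoly (N : ℕ) (f : ℝ → ℝ) : Prop :=
  ∃ p : Polynomial ℂ, p.natDegree ≤ 2 * N ∧
    ∀ θ : ℝ, Complex.exp (Complex.I * θ) ^ N * f θ = p.eval (Complex.exp (Complex.I * θ))

namespace IsTrigPoly

theorem const (c : ℝ) : IsTrigPoly 0 (fun _ => c) :=
  ⟨Polynomial.C (c : ℂ), by simp, by simp⟩

theorem mul {M N : ℕ} {f g : ℝ → ℝ} (hf : IsTrigPoly M f) (hg : IsTrigPoly N g) :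
    IsTrigPoly (M + N) (fun θ => f θ * g θ) := by
  obtain ⟨p, hp, hpf⟩ := hf
  obtain ⟨q, hq, hqg⟩ := hg
  refine ⟨p * q, Polynomial.natDegree_mul_le.trans (by omega), fun θ => ?_⟩
  rw [Polynomial.eval_mul, ← hpf, ← hqg]
  push_cast
  ring

theorem mono {M N : ℕ} {f : ℝ → ℝ} (hf : IsTrigPoly M f) (h : M ≤ N) : IsTrigPoly N f := by
  obtain ⟨p, hp, hpf⟩ := hf
  refine ⟨Polynomial.X ^ (N - M) * p, ?_, fun θ => ?_⟩
  · refine Polynomial.natDegree_mul_le.trans ?_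
    rw [Polynomial.natDegree_X_pow]
    omega
  · rw [Polynomial.eval_mul, ← hpf, Polynomial.eval_pow, Polynomial.eval_X, ← mul_assoc, ← pow_add]
    congr 2
    omega

theorem add {N : ℕ} {f g : ℝ → ℝ} (hf : IsTrigPoly N f) (hg : IsTrigPoly N g) :
    IsTrigPoly N (fun θ => f θ + g θ) := by
  obtain ⟨p, hp, hpf⟩ := hf
  obtain ⟨q, hq, hqg⟩ := hg
  refine ⟨p + q, Polynomial.natDegree_add_le_of_degree_le hp hq, fun θ => ?_⟩
  rw [Polynomial.eval_add, ← hpf, ← hqg]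
  push_cast
  ring

theorem sum {ι : Type*} {N : ℕ} (s : Finset ι) {f : ι → ℝ → ℝ}
    (hf : ∀ i ∈ s, IsTrigPoly N (f i)) : IsTrigPoly N (fun θ => ∑ i ∈ s, f i θ) := by
  classical
  induction s using Finset.induction_on with
  | empty => simpa using (const 0).mono (Nat.zero_le N)
  | insert a s ha ih =>
    simp only [Finset.sum_insert ha]
    exact (hf a (Finset.mem_insert_self a s)).add
      (ih fun i hi => hf i (Finset.mem_insert_of_mem hi))

theorem const_mul {N : ℕ} {f : ℝ → ℝ} (hf : IsTrigPoly N f) (c : ℝ) :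
    IsTrigPoly N (fun θ => c * f θ) := by
  simpa using (const c).mul hf

theorem pow {N : ℕ} {f : ℝ → ℝ} (hf : IsTrigPoly N f) (k : ℕ) :
    IsTrigPoly (k * N) (fun θ => f θ ^ k) := by
  induction k with
  | zero => simpa using const 1
  | succ k ih => simpa only [pow_succ, Nat.succ_mul] using ih.mul hf

theorem cos : IsTrigPoly 1 Real.cos := by
  refine ⟨Polynomial.C (1 / 2) * (Polynomial.X ^ 2 + 1), by compute_degree, fun θ => ?_⟩
  have h : Complex.exp (Complex.I * θ) * Complex.exp (-θ * Complex.I) = 1 := by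
    rw [← Complex.exp_add]; ring_nf; simp
  simp only [Polynomial.eval_mul, Polynomial.eval_C, Polynomial.eval_add, Polynomial.eval_pow,
    Polynomial.eval_X, Polynomial.eval_one, Complex.ofReal_cos, Complex.cos, pow_one]
  rw [mul_comm (θ : ℂ) Complex.I]
  linear_combination (1 / 2) * h

theorem sin : IsTrigPoly 1 Real.sin := by
  refine ⟨Polynomial.C (Complex.I / 2) * (1 - Polynomial.X ^ 2), by compute_degree, fun θ => ?_⟩
  have h : Complex.exp (Complex.I * θ) * Complex.exp (-θ * Complex.I) = 1 := by
    rw [← Complex.exp_add]; ring_nf; simp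
  simp only [Polynomial.eval_mul, Polynomial.eval_C, Polynomial.eval_sub, Polynomial.eval_pow,
    Polynomial.eval_X, Polynomial.eval_one, Complex.ofReal_sin, Complex.sin, pow_one]
  rw [mul_comm (θ : ℂ) Complex.I]
  linear_combination (Complex.I / 2) * h

end IsTrigPoly

/-- A polynomial of degree at most `n` grows at most like `‖z‖ ^ n` outside the unit disc. -/
theorem Polynomial.norm_eval_le_of_norm_eval_circle_le {p : Polynomial ℂ} {n : ℕ}
    (hp : p.natDegree ≤ n) {M : ℝ} (hM : ∀ z : ℂ, ‖z‖ = 1 → ‖p.eval z‖ ≤ M) {z : ℂ}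
    (hz : 1 ≤ ‖z‖) : ‖p.eval z‖ ≤ M * ‖z‖ ^ n := by
  have hz0 : z ≠ 0 := norm_pos_iff.mp (by linarith)
  -- Reversing the coefficients exchanges the exterior and the interior of the disc, where the
  -- maximum principle is available.
  have key : ∀ w : ℂ, w ≠ 0 → (p.reflect n).eval w = w ^ n * p.eval w⁻¹ := by
    intro w hw
    let _ := invertibleOfNonzero (inv_ne_zero hw)
    have := Polynomial.eval₂_reflect_mul_pow (RingHom.id ℂ) w⁻¹ n p hp
    simp only [invOf_eq_inv, inv_inv] at this
    simp only [Polynomial.eval, ← this]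
    rw [mul_left_comm, ← mul_pow, mul_inv_cancel₀ hw, one_pow, mul_one]
  have hcirc : ∀ w ∈ frontier (Metric.ball (0 : ℂ) 1), ‖(p.reflect n).eval w‖ ≤ M := by
    intro w hw
    rw [frontier_ball _ one_ne_zero, mem_sphere_zero_iff_norm] at hw
    have hw0 : w ≠ 0 := norm_pos_iff.mp (by linarith)
    rw [key w hw0, norm_mul, norm_pow, hw, one_pow, one_mul]
    exact hM _ (by simp [hw])
  have hin : ‖(p.reflect n).eval z⁻¹‖ ≤ M := by
    refine Complex.norm_le_of_forall_mem_frontier_norm_le (U := Metric.ball 0 1)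
      Metric.isBounded_ball (p.reflect n).differentiable.diffContOnCl hcirc ?_
    rw [closure_ball _ one_ne_zero, mem_closedBall_zero_iff, norm_inv]
    exact inv_le_one_of_one_le₀ hz
  rw [key _ (inv_ne_zero hz0), inv_inv, norm_mul, norm_pow, norm_inv] at hin
  have hpos : 0 < ‖z‖ ^ n := by positivity
  rw [inv_pow, inv_mul_le_iff₀ hpos] at hin
  linarith

/-- Cauchy's estimate on the circle of radius 1/N about z: there the growth bound gives |p| ≤ (1 +
1/N)^(2N) M ≤ e² M ≤ 8M. -/
theorem Polynomial.norm_eval_derivative_le_of_norm_eval_circle_le {p : Polynomial ℂ} {N : ℕ}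
    (hN : 1 ≤ N) (hp : p.natDegree ≤ 2 * N) {M : ℝ}
    (hM : ∀ z : ℂ, ‖z‖ = 1 → ‖p.eval z‖ ≤ M) {z : ℂ} (hz : ‖z‖ = 1) :
    ‖p.derivative.eval z‖ ≤ 8 * N * M := by
  have hNpos : (0 : ℝ) < N := by exact_mod_cast hN
  have hM0 : 0 ≤ M := (norm_nonneg _).trans (hM 1 (by simp))
  have hexp : (1 + 1 / (N : ℝ)) ^ (2 * N) ≤ 8 := by
    have h1 : 1 + 1 / (N : ℝ) ≤ Real.exp (1 / N) := by linarith [Real.add_one_le_exp (1 / (N : ℝ))]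
    calc (1 + 1 / (N : ℝ)) ^ (2 * N) ≤ Real.exp (1 / N) ^ (2 * N) :=
          pow_le_pow_left₀ (by positivity) h1 _
      _ = Real.exp 1 ^ 2 := by
          rw [← Real.exp_nat_mul, ← Real.exp_nat_mul]; congr 1; push_cast; field_simp
      _ ≤ 8 := by nlinarith [Real.exp_one_lt_d9, Real.exp_pos 1]
  have hsph : ∀ w ∈ Metric.sphere z (1 / N), ‖p.eval w‖ ≤ 8 * M := by
    intro w hw
    have hwn : ‖w‖ ≤ 1 + 1 / N := by
      rw [mem_sphere_iff_norm] at hw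
      calc ‖w‖ = ‖z + (w - z)‖ := by ring_nf
        _ ≤ ‖z‖ + ‖w - z‖ := norm_add_le _ _
        _ = 1 + 1 / N := by rw [hz, hw]
    rcases le_or_gt 1 ‖w‖ with h | h
    · refine (Polynomial.norm_eval_le_of_norm_eval_circle_le hp hM h).trans ?_
      have : ‖w‖ ^ (2 * N) ≤ 8 := (pow_le_pow_left₀ (norm_nonneg _) hwn _).trans hexp
      nlinarith
    · have : ‖p.eval w‖ ≤ M := by
        refine Complex.norm_le_of_forall_mem_frontier_norm_le (U := Metric.ball 0 1)
          Metric.isBounded_ball p.differentiable.diffContOnCl (fun v hv => hM v ?_)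
          (subset_closure (by simpa using h))
        simpa [frontier_ball _ one_ne_zero] using hv
      linarith
  have := Complex.norm_deriv_le_of_forall_mem_sphere_norm_le (c := z) (R := 1 / N)
    (C := 8 * M) (f := fun w => p.eval w) (by positivity) p.differentiable.diffContOnCl hsph
  rw [Polynomial.deriv] at this
  refine this.trans (le_of_eq ?_)
  field_simp

/-- Bernstein's inequality (with a non-sharp constant). -/
theorem IsTrigPoly.abs_sub_le {N : ℕ} (hN : 1 ≤ N) {f : ℝ → ℝ} (hf : IsTrigPoly N f) {M : ℝ}
    (hM : ∀ θ, |f θ| ≤ M) (a b : ℝ) : |f a - f b| ≤ 9 * N * M * |a - b| := by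
  obtain ⟨p, hp, hpf⟩ := hf
  have hnorm : ∀ θ : ℝ, ‖Complex.exp (Complex.I * θ)‖ = 1 := fun θ => by
    rw [mul_comm]; exact Complex.norm_exp_ofReal_mul_I θ
  have hcirc : ∀ z : ℂ, ‖z‖ = 1 → ‖p.eval z‖ ≤ M := by
    intro z hz
    obtain ⟨θ, rfl⟩ : ∃ θ : ℝ, z = Complex.exp (Complex.I * θ) := by
      refine ⟨Complex.arg z, ?_⟩
      conv_lhs => rw [← Complex.norm_mul_exp_arg_mul_I z, hz]
      simp [mul_comm]
    rw [← hpf, norm_mul, norm_pow, hnorm, one_pow, one_mul, Complex.norm_real]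
    exact hM θ
  have hM0 : 0 ≤ M := (abs_nonneg _).trans (hM 0)
  have hN' : (1 : ℝ) ≤ N := by exact_mod_cast hN
  -- Write f(θ) = e^(-iNθ) p(e^(iθ)). The derivative of the first factor contributes N M and that of
  -- the second 8 N M, whence the constant 9.
  set g : ℝ → ℂ := fun θ => Complex.exp (-(N * (Complex.I * θ))) *
    p.eval (Complex.exp (Complex.I * θ)) with hg
  have hgf : ∀ θ, g θ = f θ := by
    intro θ
    simp only [hg]
    rw [← hpf, ← Complex.exp_nat_mul, ← mul_assoc, ← Complex.exp_add]
    simp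
  have hder : ∀ θ : ℝ, HasDerivAt g
      (Complex.exp (-(N * (Complex.I * θ))) * (-(N * Complex.I)) *
        p.eval (Complex.exp (Complex.I * θ)) + Complex.exp (-(N * (Complex.I * θ))) *
        (p.derivative.eval (Complex.exp (Complex.I * θ)) *
          (Complex.exp (Complex.I * θ) * Complex.I))) θ := by
    intro θ
    have h0 : HasDerivAt (fun θ : ℝ => Complex.I * (θ : ℂ)) Complex.I θ := by
      simpa using (Complex.ofRealCLM.hasDerivAt (x := θ)).const_mul Complex.I
    have h1 : HasDerivAt (fun θ : ℝ => Complex.exp (-(N * (Complex.I * θ))))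
        (Complex.exp (-(N * (Complex.I * θ))) * (-(N * Complex.I))) θ :=
      ((h0.const_mul (N : ℂ)).neg).cexp
    exact h1.mul ((p.hasDerivAt _).comp θ h0.cexp)
  have hbound : ∀ θ : ℝ, ‖deriv g θ‖ ≤ 9 * N * M := by
    intro θ
    rw [(hder θ).deriv]
    have e1 : ‖Complex.exp (-(N * (Complex.I * θ)))‖ = 1 := by
      rw [Complex.exp_neg, norm_inv, Complex.exp_nat_mul, norm_pow, hnorm]; simp
    refine (norm_add_le _ _).trans ?_
    simp only [norm_mul, e1, hnorm, norm_neg, Complex.norm_I, Complex.norm_natCast, one_mul,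
      mul_one]
    have h1 := hcirc _ (hnorm θ)
    have h2 := Polynomial.norm_eval_derivative_le_of_norm_eval_circle_le hN hp hcirc (hnorm θ)
    nlinarith
  have := Convex.norm_image_sub_le_of_norm_deriv_le (s := Set.univ) (f := g) (C := 9 * N * M)
    (fun θ _ => (hder θ).differentiableAt) (fun θ _ => hbound θ) convex_univ
    (Set.mem_univ b) (Set.mem_univ a)
  rw [hgf, hgf, ← Complex.ofReal_sub, Complex.norm_real, Real.norm_eq_abs, Real.norm_eq_abs] at this
  exact this

/-! ### Geometry of the sphere -/

/-- The cosine `⟨x, y⟩` of the geodesic distance of `x, y ∈ 𝕊²`. -/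
noncomputable def cosDist (x y : Sphere2) : ℝ :=
  inner ℝ (x : EuclideanSpace ℝ (Fin 3)) (y : EuclideanSpace ℝ (Fin 3))

theorem cosDist_comm (x y : Sphere2) : cosDist x y = cosDist y x := real_inner_comm _ _

theorem Sphere2.norm_eq_one (x : Sphere2) : ‖(x : EuclideanSpace ℝ (Fin 3))‖ = 1 := by
  simp

theorem cosDist_self (x : Sphere2) : cosDist x x = 1 := by
  rw [cosDist, real_inner_self_eq_norm_sq, x.norm_eq_one, one_pow]

theorem abs_cosDist_le_one (x y : Sphere2) : |cosDist x y| ≤ 1 := by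
  simpa [cosDist] using abs_real_inner_le_norm (x : EuclideanSpace ℝ (Fin 3)) y

theorem cosDist_isometryAct (g : EuclideanSpace ℝ (Fin 3) ≃ₗᵢ[ℝ] EuclideanSpace ℝ (Fin 3))
    (x y : Sphere2) : cosDist (isometryAct g x) (isometryAct g y) = cosDist x y :=
  g.inner_map_map _ _

@[fun_prop]
theorem continuous_cosDist : Continuous fun z : Sphere2 × Sphere2 => cosDist z.1 z.2 := by
  unfold cosDist
  fun_prop

theorem continuous_isometryAct (g : EuclideanSpace ℝ (Fin 3) ≃ₗᵢ[ℝ] EuclideanSpace ℝ (Fin 3)) :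
    Continuous (isometryAct g) :=
  (g.continuous.comp continuous_subtype_val).subtype_mk _

instance : Fact (Module.finrank ℝ (EuclideanSpace ℝ (Fin 3)) = 2 + 1) := ⟨by simp⟩

theorem Sphere2.exists_cosDist_eq_zero (x : Sphere2) : ∃ w : Sphere2, cosDist x w = 0 := by
  have h : (Module.finrank ℝ (ℝ ∙ (x : EuclideanSpace ℝ (Fin 3)))ᗮ) = 2 :=
    Submodule.finrank_orthogonal_span_singleton (n := 2) (by
      intro h; have := x.norm_eq_one; simp [h] at this)
  have : Nontrivial (ℝ ∙ (x : EuclideanSpace ℝ (Fin 3)))ᗮ :=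
    Module.nontrivial_of_finrank_pos (R := ℝ) (by omega)
  obtain ⟨v, hv⟩ := exists_ne (0 : (ℝ ∙ (x : EuclideanSpace ℝ (Fin 3)))ᗮ)
  have hv0 : (v : EuclideanSpace ℝ (Fin 3)) ≠ 0 := by simpa using hv
  refine ⟨⟨‖(v : EuclideanSpace ℝ (Fin 3))‖⁻¹ • (v : EuclideanSpace ℝ (Fin 3)), ?_⟩, ?_⟩
  · simp [norm_smul, hv0]
  · have := Submodule.mem_orthogonal_singleton_iff_inner_right.mp v.2
    simp [cosDist, inner_smul_right, this]

/-- Gram–Schmidt: w is the normalised component of y orthogonal to x. If y = ±x this component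
vanishes and any orthogonal w serves. -/
theorem Sphere2.exists_eq_cosDist_smul_add (x y : Sphere2) : ∃ w : Sphere2, cosDist x w = 0 ∧
    (y : EuclideanSpace ℝ (Fin 3)) = cosDist x y • (x : EuclideanSpace ℝ (Fin 3)) +
      √(1 - cosDist x y ^ 2) • (w : EuclideanSpace ℝ (Fin 3)) := by
  set t := cosDist x y with ht
  set v : EuclideanSpace ℝ (Fin 3) := y - t • (x : EuclideanSpace ℝ (Fin 3)) with hv
  have hxy : inner ℝ (x : EuclideanSpace ℝ (Fin 3)) y = t := rfl
  have hyx : inner ℝ (y : EuclideanSpace ℝ (Fin 3)) x = t := by rw [real_inner_comm, hxy]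
  have hnv : ‖v‖ ^ 2 = 1 - t ^ 2 := by
    rw [hv, norm_sub_sq_real, inner_smul_right, hyx, norm_smul, x.norm_eq_one, y.norm_eq_one,
      mul_one, Real.norm_eq_abs, sq_abs]
    ring
  have hs : √(1 - t ^ 2) = ‖v‖ := by rw [← hnv, Real.sqrt_sq (norm_nonneg _)]
  by_cases h0 : v = 0
  · obtain ⟨w, hw⟩ := x.exists_cosDist_eq_zero
    refine ⟨w, hw, ?_⟩
    rw [hs, h0, norm_zero, zero_smul, add_zero]
    exact sub_eq_zero.mp h0
  · refine ⟨⟨‖v‖⁻¹ • v, by simp [norm_smul, h0]⟩, ?_, ?_⟩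
    · have : inner ℝ (x : EuclideanSpace ℝ (Fin 3)) v = 0 := by
        rw [hv, inner_sub_right, inner_smul_right, hxy, real_inner_self_eq_norm_sq, x.norm_eq_one]
        ring
      simp [cosDist, inner_smul_right, this]
    · rw [hs, smul_smul, mul_inv_cancel₀ (norm_ne_zero_iff.mpr h0), one_smul, hv]
      abel

theorem geodesicDist_nonneg (x y : Sphere2) : 0 ≤ geodesicDist x y := Real.arccos_nonneg _

theorem dist_sq_eq_cosDist (x y : Sphere2) : dist x y ^ 2 = 2 - 2 * cosDist x y := by
  rw [Subtype.dist_eq, dist_eq_norm, norm_sub_sq_real, x.norm_eq_one, y.norm_eq_one, cosDist]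
  ring

/-- The chord is 2 sin(d/2); Jordan's inequality and π ≤ 4 give sin(d/2) ≥ d/π ≥ d/4. -/
theorem geodesicDist_le_two_mul_dist (x y : Sphere2) : geodesicDist x y ≤ 2 * dist x y := by
  set d := geodesicDist x y with hd
  have h0 : 0 ≤ d := geodesicDist_nonneg x y
  have hpi : d ≤ Real.pi := Real.arccos_le_pi _
  have hcos : Real.cos d = cosDist x y :=
    Real.cos_arccos (abs_le.mp (abs_cosDist_le_one x y)).1 (abs_le.mp (abs_cosDist_le_one x y)).2
  have hsin : 2 / Real.pi * (d / 2) ≤ Real.sin (d / 2) :=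
    Real.mul_le_sin (by linarith) (by linarith)
  have hsq : dist x y ^ 2 = (2 * Real.sin (d / 2)) ^ 2 := by
    rw [dist_sq_eq_cosDist, ← hcos]
    have := Real.cos_two_mul (d / 2)
    rw [mul_div_cancel₀ d two_ne_zero] at this
    have h2 := Real.sin_sq_add_cos_sq (d / 2)
    nlinarith
  have hdist : dist x y = 2 * Real.sin (d / 2) := by
    have : 0 ≤ Real.sin (d / 2) := Real.sin_nonneg_of_nonneg_of_le_pi (by linarith) (by linarith)
    exact (sq_eq_sq₀ dist_nonneg (by linarith)).mp hsq
  have h4 : d / Real.pi ≤ Real.sin (d / 2) := by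
    calc d / Real.pi = 2 / Real.pi * (d / 2) := by ring
      _ ≤ _ := hsin
  have h5 : d / 4 ≤ d / Real.pi :=
    div_le_div_of_nonneg_left h0 Real.pi_pos Real.pi_le_four
  rw [hdist]
  linarith

/-! ### Isometries of the sphere -/

/-- The half-turn about the axis x + y exchanges x and y; if y = -x, any axis orthogonal to x works.
As reflection in a line of ℝ³ it has determinant (-1)². -/
theorem exists_isRotation_isometryAct_eq (x y : Sphere2) :
    ∃ g : EuclideanSpace ℝ (Fin 3) ≃ₗᵢ[ℝ] EuclideanSpace ℝ (Fin 3),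
      IsRotation g ∧ isometryAct g x = y := by
  obtain ⟨u, hu0, hu⟩ : ∃ u : EuclideanSpace ℝ (Fin 3), u ≠ 0 ∧
      (ℝ ∙ u).reflection (x : EuclideanSpace ℝ (Fin 3)) = y := by
    by_cases h : (x : EuclideanSpace ℝ (Fin 3)) + y = 0
    · obtain ⟨w, hw⟩ := x.exists_cosDist_eq_zero
      refine ⟨w, fun hw0 => by have := w.norm_eq_one; simp [hw0] at this, ?_⟩
      rw [Submodule.reflection_mem_subspace_orthogonalComplement_eq_neg, eq_comm]
      · exact eq_neg_of_add_eq_zero_right h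
      · rw [Submodule.mem_orthogonal_singleton_iff_inner_right, real_inner_comm]
        exact hw
    · refine ⟨_, h, ?_⟩
      have h1 := Submodule.reflection_sub (v := (x : EuclideanSpace ℝ (Fin 3)))
        (w := -(y : EuclideanSpace ℝ (Fin 3))) (by simp)
      rw [sub_neg_eq_add, Submodule.reflection_orthogonal_apply] at h1
      exact neg_injective h1
  refine ⟨(ℝ ∙ u).reflection, ?_, Subtype.ext hu⟩
  have h2 : (Module.finrank ℝ (ℝ ∙ u)ᗮ) = 2 :=
    Submodule.finrank_orthogonal_span_singleton (n := 2) hu0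
  rw [IsRotation, Submodule.det_reflection, h2]
  norm_num

open scoped Pointwise in
-- The surface measure of a set is defined through the volume of the cone over it, and g preserves
-- volume and commutes with forming cones.
theorem measurePreserving_isometryAct
    (g : EuclideanSpace ℝ (Fin 3) ≃ₗᵢ[ℝ] EuclideanSpace ℝ (Fin 3)) :
    MeasurePreserving (isometryAct g) sphereMeasure sphereMeasure := by
  have hm : Measurable (isometryAct g) := (continuous_isometryAct g).measurable
  refine ⟨hm, Measure.ext fun s hs => ?_⟩
  rw [Measure.map_apply hm hs, sphereMeasure, Measure.toSphere_apply' _ hs,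
    Measure.toSphere_apply' _ (hm hs)]
  congr 1
  have hg : MeasurePreserving g.toHomeomorph.toMeasurableEquiv
    (volume : Measure (EuclideanSpace ℝ (Fin 3))) volume := g.measurePreserving
  rw [← hg.measure_preimage_equiv (Set.Ioo (0 : ℝ) 1 • Subtype.val '' s)]
  congr 1
  ext v
  have hgv : g.toHomeomorph.toMeasurableEquiv v = g v := rfl
  simp only [Set.mem_smul, Set.mem_image, Set.mem_preimage, hgv]
  constructor
  · rintro ⟨r, hr, _, ⟨z, hz, rfl⟩, rfl⟩
    exact ⟨r, hr, g z, ⟨isometryAct g z, hz, rfl⟩, by simp⟩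
  · rintro ⟨r, hr, _, ⟨z, hz, rfl⟩, hv⟩
    refine ⟨r, hr, g.symm z, ⟨isometryAct g.symm z, ?_, rfl⟩, ?_⟩
    · have : isometryAct g (isometryAct g.symm z) = z := Subtype.ext (by simp [isometryAct])
      rwa [this]
    · apply g.injective
      rw [map_smul, g.apply_symm_apply]
      exact hv

instance : IsFiniteMeasure sphereMeasure := by unfold sphereMeasure; infer_instance

theorem measurableEmbedding_isometryAct
    (g : EuclideanSpace ℝ (Fin 3) ≃ₗᵢ[ℝ] EuclideanSpace ℝ (Fin 3)) :
    MeasurableEmbedding (isometryAct g) :=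
  ((continuous_isometryAct g).isClosedEmbedding fun _ _ h => Subtype.ext
    (g.injective (congrArg Subtype.val h))).measurableEmbedding

theorem integral_comp_isometryAct
    (g : EuclideanSpace ℝ (Fin 3) ≃ₗᵢ[ℝ] EuclideanSpace ℝ (Fin 3)) (f : Sphere2 → ℝ) :
    ∫ y, f (isometryAct g y) ∂sphereMeasure = ∫ y, f y ∂sphereMeasure :=
  (measurePreserving_isometryAct g).integral_comp (measurableEmbedding_isometryAct g) f

/-! ### Zonal convolutions -/

/-- The convolution `x ↦ ∫ f(y) q(⟨x, y⟩) dσ(y)` of a function with a zonal polynomial kernel. -/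
noncomputable def zonalConv (q : Polynomial ℝ) (f : Sphere2 → ℝ) (x : Sphere2) : ℝ :=
  ∫ y, f y * q.eval (cosDist x y) ∂sphereMeasure

@[fun_prop]
theorem continuous_eval_cosDist (q : Polynomial ℝ) (x : Sphere2) :
    Continuous fun y => q.eval (cosDist x y) :=
  q.continuous.comp (continuous_cosDist.comp (Continuous.prodMk_right x))

/-- A bound for a polynomial on `[-1, 1]`. -/
theorem Polynomial.exists_abs_eval_cosDist_le (q : Polynomial ℝ) :
    ∃ M, 0 ≤ M ∧ ∀ x y : Sphere2, |q.eval (cosDist x y)| ≤ M := by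
  obtain ⟨M, hM⟩ := (isCompact_Icc (a := (-1 : ℝ)) (b := 1)).exists_bound_of_continuousOn
    q.continuous.continuousOn
  refine ⟨M, (norm_nonneg _).trans (hM 0 (by norm_num)), fun x y => ?_⟩
  exact hM _ (abs_le.mp (abs_cosDist_le_one x y))

theorem integrable_mul_of_continuous {f h : Sphere2 → ℝ} (hf : Integrable f sphereMeasure)
    (hh : Continuous h) : Integrable (fun y => f y * h y) sphereMeasure := by
  obtain ⟨M, hM⟩ := isCompact_univ.exists_bound_of_continuousOn hh.continuousOn
  exact hf.mul_bdd hh.aestronglyMeasurable (Filter.Eventually.of_forall fun y => hM y trivial)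

/-- The binomial expansion separates θ from y: the integrals over y become coefficients of the
products cos^k θ sin^(n-k) θ with n ≤ N. -/
theorem isTrigPoly_integral_mul_eval {q : Polynomial ℝ} {N : ℕ} (hq : q.natDegree ≤ N)
    {f a b : Sphere2 → ℝ} (hf : Integrable f sphereMeasure) (ha : Continuous a)
    (hb : Continuous b) :
    IsTrigPoly N fun θ =>
      ∫ y, f y * q.eval (Real.cos θ * a y + Real.sin θ * b y) ∂sphereMeasure := by
  have h : ∀ θ, ∫ y, f y * q.eval (Real.cos θ * a y + Real.sin θ * b y) ∂sphereMeasure =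
      ∑ n ∈ Finset.range (q.natDegree + 1), ∑ k ∈ Finset.range (n + 1),
        (q.coeff n * n.choose k * ∫ y, f y * (a y ^ k * b y ^ (n - k)) ∂sphereMeasure) *
          (Real.cos θ ^ k * Real.sin θ ^ (n - k)) := by
    intro θ
    have hint : ∀ n k : ℕ, Integrable (fun y => f y * (a y ^ k * b y ^ (n - k))) sphereMeasure :=
      fun n k => integrable_mul_of_continuous hf (by fun_prop)
    have hpt : ∀ y, f y * q.eval (Real.cos θ * a y + Real.sin θ * b y) =
        ∑ n ∈ Finset.range (q.natDegree + 1), ∑ k ∈ Finset.range (n + 1),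
          (q.coeff n * n.choose k * (Real.cos θ ^ k * Real.sin θ ^ (n - k))) *
            (f y * (a y ^ k * b y ^ (n - k))) := by
      intro y
      rw [Polynomial.eval_eq_sum_range, Finset.mul_sum]
      refine Finset.sum_congr rfl fun n _ => ?_
      rw [add_pow, Finset.mul_sum, Finset.mul_sum]
      refine Finset.sum_congr rfl fun k _ => ?_
      rw [mul_pow, mul_pow]
      ring
    simp only [hpt]
    rw [integral_finsetSum _ fun n _ => integrable_finsetSum _ fun k _ => (hint n k).const_mul _]
    refine Finset.sum_congr rfl fun n _ => ?_
    rw [integral_finsetSum _ fun k _ => (hint n k).const_mul _]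
    refine Finset.sum_congr rfl fun k _ => ?_
    rw [integral_const_mul]
    ring
  simp only [h]
  refine IsTrigPoly.sum _ fun n hn => IsTrigPoly.sum _ fun k hk => IsTrigPoly.const_mul ?_ _
  refine ((IsTrigPoly.cos.pow k).mul (IsTrigPoly.sin.pow (n - k))).mono ?_
  simp only [Finset.mem_range] at hn hk
  omega

/-! ### Bernstein and Nikolskii inequalities on the sphere -/

/-- The point at angle `θ` on the great circle through `x` and an orthogonal point `w`. -/
noncomputable def greatCircle (x w : Sphere2) (h : cosDist x w = 0) (θ : ℝ) : Sphere2 :=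
  ⟨Real.cos θ • (x : EuclideanSpace ℝ (Fin 3)) + Real.sin θ • (w : EuclideanSpace ℝ (Fin 3)), by
    have h' : inner ℝ (x : EuclideanSpace ℝ (Fin 3)) w = 0 := h
    rw [mem_sphere_zero_iff_norm, ← sq_eq_sq₀ (norm_nonneg _) zero_le_one, norm_add_sq_real,
      inner_smul_left, inner_smul_right, h', norm_smul, norm_smul, x.norm_eq_one, w.norm_eq_one]
    simp⟩

theorem cosDist_greatCircle (x w : Sphere2) (h : cosDist x w = 0) (θ : ℝ) (y : Sphere2) :
    cosDist (greatCircle x w h θ) y = Real.cos θ * cosDist x y + Real.sin θ * cosDist w y := by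
  simp [cosDist, greatCircle, inner_add_left, inner_smul_left]

/-- Bernstein's inequality on the sphere. -/
theorem abs_zonalConv_sub_le {q : Polynomial ℝ} {N : ℕ} (hN : 1 ≤ N) (hq : q.natDegree ≤ N)
    {f : Sphere2 → ℝ} (hf : Integrable f sphereMeasure) {M : ℝ}
    (hM : ∀ x, |zonalConv q f x| ≤ M) (x y : Sphere2) :
    |zonalConv q f x - zonalConv q f y| ≤ 9 * N * M * geodesicDist x y := by
  obtain ⟨w, hw, hy⟩ := x.exists_eq_cosDist_smul_add y
  -- Along the great circle from x to y, parametrised by arc length, the convolution is a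
  -- trigonometric polynomial of degree N, so the inequality on the circle applies.
  set F : ℝ → ℝ := fun θ => zonalConv q f (greatCircle x w hw θ) with hF
  have htrig : IsTrigPoly N F := by
    simp only [hF, zonalConv, cosDist_greatCircle]
    exact isTrigPoly_integral_mul_eval hq hf
      (continuous_cosDist.comp (Continuous.prodMk_right x))
      (continuous_cosDist.comp (Continuous.prodMk_right w))
  have h0 : greatCircle x w hw 0 = x := Subtype.ext (by simp [greatCircle])
  have h1 : greatCircle x w hw (geodesicDist x y) = y := by
    apply Subtype.ext
    have hb := abs_le.mp (abs_cosDist_le_one x y)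
    have hd : geodesicDist x y = Real.arccos (cosDist x y) := rfl
    rw [hy]
    simp only [greatCircle, hd, Real.cos_arccos hb.1 hb.2, Real.sin_arccos]
  have := htrig.abs_sub_le hN (fun θ => hM _) 0 (geodesicDist x y)
  simp only [hF, h0, h1, zero_sub, abs_neg, abs_of_nonneg (geodesicDist_nonneg x y)] at this
  exact this

theorem continuous_zonalConv (q : Polynomial ℝ) {f : Sphere2 → ℝ}
    (hf : Integrable f sphereMeasure) : Continuous (zonalConv q f) := by
  obtain ⟨M, -, hM⟩ := q.exists_abs_eval_cosDist_le
  refine continuous_of_dominated (bound := fun y => M * |f y|) (fun x =>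
    (integrable_mul_of_continuous hf (continuous_eval_cosDist q x)).aestronglyMeasurable)
    (fun x => Filter.Eventually.of_forall fun y => ?_) (hf.abs.const_mul M)
    (Filter.Eventually.of_forall fun y => ?_)
  · rw [Real.norm_eq_abs, abs_mul, mul_comm]
    exact mul_le_mul_of_nonneg_right (hM x y) (abs_nonneg _)
  · exact continuous_const.mul
      (q.continuous.comp (continuous_cosDist.comp (Continuous.prodMk_left y)))

/-- The true order is ε². The cubic lower bound suffices, since the loss only raises the order of
the moments needed later. -/
theorem exists_sphereMeasure_ball_ge : ∃ c : ℝ, 0 < c ∧ ∀ (x : Sphere2) (ε : ℝ), 0 < ε → ε ≤ 1 →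
    c * ε ^ 3 ≤ sphereMeasure.real (Metric.ball x ε) := by
  refine ⟨3 / 64 * (volume : Measure (EuclideanSpace ℝ (Fin 3))).real (Metric.ball 0 1),
    mul_pos (by norm_num) (ENNReal.toReal_pos (Metric.measure_ball_pos _ _ one_pos).ne'
      measure_ball_lt_top.ne), fun x ε hε hε1 => ?_⟩
  refine le_trans (le_of_eq ?_)
    (Measure.toSphereBallBound_mul_measureReal_unitBall_le_toSphere_ball _ hε x)
  have : min ε.toNNReal 2 = ε.toNNReal := by
    rw [min_eq_left]
    rw [Real.toNNReal_le_iff_le_coe]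
    exact hε1.trans (by norm_num)
  rw [Measure.toSphereBallBound, if_pos ⟨by simp, hε⟩, this]
  simp [Real.coe_toNNReal _ hε.le]
  ring

/-- A Nikolskii inequality on the sphere (with a non-sharp power of the degree). -/
theorem exists_abs_zonalConv_pow_le : ∃ c : ℝ, 0 < c ∧ ∀ (q : Polynomial ℝ) (N : ℕ), 1 ≤ N →
    q.natDegree ≤ N → ∀ f : Sphere2 → ℝ, Integrable f sphereMeasure → ∀ (p : ℕ) (x : Sphere2),
    |zonalConv q f x| ^ p ≤ c * N ^ 3 * 2 ^ p * ∫ y, |zonalConv q f y| ^ p ∂sphereMeasure := by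
  obtain ⟨c, hc, hball⟩ := exists_sphereMeasure_ball_ge
  refine ⟨36 ^ 3 / c, by positivity, fun q N hN hq f hf p x => ?_⟩
  have hNpos : (1 : ℝ) ≤ N := by exact_mod_cast hN
  have hcont := continuous_zonalConv q hf
  obtain ⟨z, -, hz⟩ := isCompact_univ.exists_isMaxOn ⟨x, Set.mem_univ x⟩
    (hcont.abs.continuousOn)
  set M := |zonalConv q f z| with hMdef
  have hM : ∀ y, |zonalConv q f y| ≤ M := fun y => hz (Set.mem_univ y)
  have hM0 : 0 ≤ M := abs_nonneg _
  -- With this radius Bernstein's inequality allows a change of at most 9 N M · 2ε = M/2 over the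
  -- ball about the maximum point z, so the modulus stays above M/2 there.
  set ε : ℝ := 1 / (36 * N) with hε
  have hε0 : 0 < ε := by positivity
  have hε1 : ε ≤ 1 := by
    rw [hε, div_le_one (by positivity)]
    linarith
  have hlow : ∀ y ∈ Metric.ball z ε, M / 2 ≤ |zonalConv q f y| := by
    intro y hy
    have h1 := abs_zonalConv_sub_le hN hq hf hM z y
    have h2 := geodesicDist_le_two_mul_dist z y
    rw [Metric.mem_ball, dist_comm] at hy
    have h3 : 9 * N * M * geodesicDist z y ≤ M / 2 := by
      calc 9 * N * M * geodesicDist z y ≤ 9 * N * M * (2 * ε) := by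
            gcongr
            linarith
        _ = M / 2 := by rw [hε]; field_simp; ring
    have h4 := abs_sub_abs_le_abs_sub (zonalConv q f z) (zonalConv q f y)
    linarith
  have hint : Integrable (fun y => |zonalConv q f y| ^ p) sphereMeasure := by
    simpa using integrable_mul_of_continuous (integrable_const (1 : ℝ)) (hcont.abs.pow p)
  have hge : (M / 2) ^ p * (c * ε ^ 3) ≤ ∫ y, |zonalConv q f y| ^ p ∂sphereMeasure := by
    calc (M / 2) ^ p * (c * ε ^ 3)
        ≤ (M / 2) ^ p * sphereMeasure.real (Metric.ball z ε) := by
          gcongr; exact hball z ε hε0 hε1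
      _ = ∫ _ in Metric.ball z ε, (M / 2) ^ p ∂sphereMeasure := by
          rw [setIntegral_const, smul_eq_mul, mul_comm]
      _ ≤ ∫ y in Metric.ball z ε, |zonalConv q f y| ^ p ∂sphereMeasure :=
          setIntegral_mono_on (integrable_const _) hint.integrableOn measurableSet_ball
            fun y hy => pow_le_pow_left₀ (by positivity) (hlow y hy) p
      _ ≤ _ := setIntegral_le_integral hint (Filter.Eventually.of_forall fun y => by positivity)
  calc |zonalConv q f x| ^ p ≤ M ^ p := pow_le_pow_left₀ (abs_nonneg _) (hM x) p
    _ = 36 ^ 3 / c * N ^ 3 * 2 ^ p * ((M / 2) ^ p * (c * ε ^ 3)) := by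
        rw [hε, div_pow M 2 p]
        field_simp
    _ ≤ _ := by gcongr

/-! ### Legendre polynomials -/

theorem natDegree_X_sq_sub_one_pow (l : ℕ) :
    (((Polynomial.X : Polynomial ℝ) ^ 2 - 1) ^ l).natDegree = 2 * l := by
  rw [Polynomial.natDegree_pow, ← Polynomial.C_1, Polynomial.natDegree_X_pow_sub_C, mul_comm]

theorem monic_X_sq_sub_one_pow (l : ℕ) :
    (((Polynomial.X : Polynomial ℝ) ^ 2 - 1) ^ l).Monic := by
  rw [← Polynomial.C_1]
  exact (Polynomial.monic_X_pow_sub_C _ two_ne_zero).pow l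

theorem natDegree_legendrePoly_le (l : ℕ) : (legendrePoly l).natDegree ≤ l := by
  refine (Polynomial.natDegree_C_mul_le _ _).trans
    ((Polynomial.natDegree_iterate_derivative _ _).trans ?_)
  rw [natDegree_X_sq_sub_one_pow]
  omega

theorem coeff_legendrePoly_ne_zero (l : ℕ) : (legendrePoly l).coeff l ≠ 0 := by
  rw [legendrePoly, Polynomial.coeff_C_mul, Polynomial.coeff_iterate_derivative,
    show l + l = 2 * l by ring, ← natDegree_X_sq_sub_one_pow l, Polynomial.coeff_natDegree,
    monic_X_sq_sub_one_pow, natDegree_X_sq_sub_one_pow]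
  have : (2 * l).descFactorial l ≠ 0 := by
    rw [Ne, Nat.descFactorial_eq_zero_iff_lt]; omega
  refine mul_ne_zero (by positivity) ?_
  rw [nsmul_eq_mul, mul_one]
  exact_mod_cast this

/-- In Leibniz's formula only the term with all l derivatives on (X - a)^l survives at a. -/
theorem eval_iterate_derivative_X_sub_C_pow_mul (a : ℝ) (l : ℕ) (q : Polynomial ℝ) :
    (Polynomial.derivative^[l] ((Polynomial.X - Polynomial.C a) ^ l * q)).eval a =
      l.factorial * q.eval a := by
  rw [Polynomial.iterate_derivative_mul, Polynomial.eval_finsetSum,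
    Finset.sum_eq_single_of_mem 0 (by simp)]
  · simp [Polynomial.iterate_derivative_X_sub_pow_self]
  · intro k hk hk0
    have : l - (l - k) ≠ 0 := by simp at hk; omega
    simp [Polynomial.iterate_derivative_X_sub_pow, this]

theorem eval_iterate_derivative_X_sq_sub_one_pow_of_lt {l k : ℕ} (h : k < l) {t : ℝ}
    (ht : t ^ 2 = 1) :
    (Polynomial.derivative^[k] (((Polynomial.X : Polynomial ℝ) ^ 2 - 1) ^ l)).eval t = 0 := by
  obtain ⟨r, hr⟩ := Polynomial.pow_sub_dvd_iterate_derivative_pow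
    ((Polynomial.X : Polynomial ℝ) ^ 2 - 1) l k
  have : l - k ≠ 0 := by omega
  simp [hr, ht, this]

theorem eval_one_legendrePoly (l : ℕ) : (legendrePoly l).eval 1 = 1 := by
  have : ((Polynomial.X : Polynomial ℝ) ^ 2 - 1) ^ l =
      (Polynomial.X - Polynomial.C 1) ^ l * (Polynomial.X + 1) ^ l := by
    rw [← mul_pow, Polynomial.C_1]; ring
  rw [legendrePoly, Polynomial.eval_mul, this, eval_iterate_derivative_X_sub_C_pow_mul]
  simp only [Polynomial.eval_C, Polynomial.eval_pow, Polynomial.eval_add, Polynomial.eval_X,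
    Polynomial.eval_one]
  norm_num
  field_simp

theorem eval_neg_one_legendrePoly (l : ℕ) : (legendrePoly l).eval (-1) = (-1) ^ l := by
  have : ((Polynomial.X : Polynomial ℝ) ^ 2 - 1) ^ l =
      (Polynomial.X - Polynomial.C (-1)) ^ l * (Polynomial.X - 1) ^ l := by
    rw [← mul_pow, Polynomial.C_neg, Polynomial.C_1]; ring
  rw [legendrePoly, Polynomial.eval_mul, this, eval_iterate_derivative_X_sub_C_pow_mul]
  simp only [Polynomial.eval_C, Polynomial.eval_pow, Polynomial.eval_sub, Polynomial.eval_X,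
    Polynomial.eval_one]
  rw [show (-1 - 1 : ℝ) = -1 * 2 by norm_num, mul_pow]
  field_simp

theorem Polynomial.intervalIntegrable_eval (p : Polynomial ℝ) (a b : ℝ) :
    IntervalIntegrable (fun t => p.eval t) volume a b :=
  p.continuous.intervalIntegrable a b

theorem Polynomial.integral_eval_derivative (p : Polynomial ℝ) (a b : ℝ) :
    ∫ t in a..b, p.derivative.eval t = p.eval b - p.eval a :=
  intervalIntegral.integral_eq_sub_of_hasDerivAt (fun t _ => p.hasDerivAt t)
    (p.derivative.intervalIntegrable_eval a b)

/-- Integration by parts k times; the boundary terms vanish because ±1 are zeros of order l of (X² -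
1)^l. -/
theorem integral_iterate_derivative_X_sq_sub_one_pow_mul (l k : ℕ) (hk : k ≤ l)
    (q : Polynomial ℝ) :
    ∫ t in (-1 : ℝ)..1, (Polynomial.derivative^[k] ((Polynomial.X ^ 2 - 1) ^ l) * q).eval t =
      (-1) ^ k * ∫ t in (-1 : ℝ)..1,
        (((Polynomial.X : Polynomial ℝ) ^ 2 - 1) ^ l * Polynomial.derivative^[k] q).eval t := by
  induction k generalizing q with
  | zero => simp
  | succ k ih =>
    have h := Polynomial.integral_eval_derivative
      (Polynomial.derivative^[k] ((Polynomial.X ^ 2 - 1) ^ l) * q) (-1) 1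
    rw [Polynomial.eval_mul, Polynomial.eval_mul,
      eval_iterate_derivative_X_sq_sub_one_pow_of_lt (by omega) (by norm_num),
      eval_iterate_derivative_X_sq_sub_one_pow_of_lt (by omega) (by norm_num),
      Polynomial.derivative_mul] at h
    simp only [Polynomial.eval_add, ← Function.iterate_succ_apply'] at h
    rw [intervalIntegral.integral_add (Polynomial.intervalIntegrable_eval _ _ _)
      (Polynomial.intervalIntegrable_eval _ _ _), ih (by omega)] at h
    rw [pow_succ (-1 : ℝ) k, Function.iterate_succ_apply Polynomial.derivative k q]
    linarith

theorem integral_legendrePoly_mul_of_natDegree_lt {l : ℕ} {q : Polynomial ℝ}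
    (hq : q.natDegree < l) : ∫ t in (-1 : ℝ)..1, (legendrePoly l * q).eval t = 0 := by
  have h := integral_iterate_derivative_X_sq_sub_one_pow_mul l l le_rfl q
  rw [Polynomial.iterate_derivative_eq_zero hq] at h
  simp only [mul_zero, Polynomial.eval_zero, intervalIntegral.integral_zero] at h
  rw [legendrePoly]
  simp only [mul_assoc, Polynomial.eval_C_mul]
  rw [intervalIntegral.integral_const_mul, h, mul_zero]

theorem Polynomial.natDegree_lt_or_eq_zero_of_coeff_eq_zero {p : Polynomial ℝ} {n : ℕ}
    (hp : p.natDegree ≤ n) (h0 : p.coeff n = 0) : p.natDegree < n ∨ p = 0 := by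
  by_contra! h
  have : p.natDegree = n := le_antisymm hp h.1
  rw [← this, Polynomial.coeff_natDegree, Polynomial.leadingCoeff_eq_zero] at h0
  exact h.2 h0

/-- Integrate (X P²)' = P² + 2 P · X P'. The polynomial X P' - l P has lower degree, so it is
orthogonal to P, and P(±1)² = 1 turns the identity into 2 = (1 + 2l) I. -/
theorem integral_legendrePoly_sq (l : ℕ) :
    ∫ t in (-1 : ℝ)..1, (legendrePoly l * legendrePoly l).eval t = 2 / (2 * l + 1) := by
  set p := legendrePoly l with hp
  set I := ∫ t in (-1 : ℝ)..1, (p * p).eval t with hI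
  have h1 : ∫ t in (-1 : ℝ)..1, (p * (Polynomial.X * p.derivative)).eval t = l * I := by
    set r := Polynomial.X * p.derivative - Polynomial.C (l : ℝ) * p with hr
    have hrdeg : r.natDegree ≤ l := by
      refine (Polynomial.natDegree_sub_le _ _).trans (max_le ?_
        ((Polynomial.natDegree_C_mul_le _ _).trans (natDegree_legendrePoly_le l)))
      rcases Nat.eq_zero_or_pos l with h | h
      · have : p.derivative = 0 := by
          apply Polynomial.derivative_of_natDegree_zero
          have : p.natDegree ≤ l := natDegree_legendrePoly_le l
          omega
        simp [this]
      · refine Polynomial.natDegree_mul_le.trans ?_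
        have := Polynomial.natDegree_derivative_le p
        have : p.natDegree ≤ l := natDegree_legendrePoly_le l
        rw [Polynomial.natDegree_X]
        omega
    have hr0 : r.coeff l = 0 := by
      rw [hr, Polynomial.coeff_sub, Polynomial.coeff_C_mul]
      cases l with
      | zero => simp
      | succ n => rw [Polynomial.coeff_X_mul, Polynomial.coeff_derivative]; push_cast; ring
    have hint : ∫ t in (-1 : ℝ)..1, (p * r).eval t = 0 := by
      rcases Polynomial.natDegree_lt_or_eq_zero_of_coeff_eq_zero hrdeg hr0 with h | h
      · exact integral_legendrePoly_mul_of_natDegree_lt h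
      · simp [h]
    have : p * (Polynomial.X * p.derivative) = p * r + Polynomial.C (l : ℝ) * (p * p) := by
      rw [hr]; ring
    rw [this]
    simp only [Polynomial.eval_add, Polynomial.eval_C_mul]
    rw [intervalIntegral.integral_add (Polynomial.intervalIntegrable_eval _ _ _)
      ((Polynomial.intervalIntegrable_eval _ _ _).const_mul _), hint,
      intervalIntegral.integral_const_mul, zero_add]
  have h2 := Polynomial.integral_eval_derivative (Polynomial.X * (p * p)) (-1) 1
  have h3 : (Polynomial.X * (p * p)).derivative =
      p * p + Polynomial.C 2 * (p * (Polynomial.X * p.derivative)) := by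
    rw [Polynomial.derivative_mul, Polynomial.derivative_X, Polynomial.derivative_mul,
      show (Polynomial.C 2 : Polynomial ℝ) = 2 from rfl]
    ring
  have hsq : ((-1 : ℝ) ^ l) * (-1) ^ l = 1 := by rw [← mul_pow]; norm_num
  simp only [h3, Polynomial.eval_add, Polynomial.eval_C_mul] at h2
  rw [intervalIntegral.integral_add (Polynomial.intervalIntegrable_eval _ _ _)
      ((Polynomial.intervalIntegrable_eval _ _ _).const_mul _),
      intervalIntegral.integral_const_mul, h1, ← hI] at h2
  simp only [Polynomial.eval_mul, Polynomial.eval_X, hp, eval_one_legendrePoly,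
    eval_neg_one_legendrePoly, hsq] at h2
  rw [eq_div_iff (by positivity)]
  linarith

/-- A polynomial with vanishing `L²` norm on `[-1, 1]` vanishes. -/
theorem Polynomial.eq_zero_of_integral_mul_self_eq_zero {p : Polynomial ℝ}
    (h : ∫ t in (-1 : ℝ)..1, (p * p).eval t = 0) : p = 0 := by
  have hcont : ContinuousOn (fun t => (p * p).eval t) (Set.Icc (-1) 1) :=
    (p * p).continuous.continuousOn
  by_contra hp
  obtain ⟨t, ht, hne⟩ : ∃ t ∈ Set.Icc (-1 : ℝ) 1, p.eval t ≠ 0 := by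
    by_contra! hall
    exact hp (Polynomial.eq_zero_of_infinite_isRoot p
      ((Set.Icc_infinite (by norm_num : (-1 : ℝ) < 1)).mono fun t ht => hall t ht))
  have : 0 < ∫ t in (-1 : ℝ)..1, (p * p).eval t :=
    intervalIntegral.integral_pos (by norm_num) hcont
      (fun t _ => by rw [Polynomial.eval_mul]; exact mul_self_nonneg _)
      ⟨t, ht, by rw [Polynomial.eval_mul]; exact mul_self_pos.mpr hne⟩
  linarith

/-! ### Integrals of zonal polynomials -/

/-- The north pole `(0, 0, 1)`. -/
noncomputable def northPole : Sphere2 := ⟨EuclideanSpace.single 2 1, by simp⟩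

theorem cosDist_northPole (y : Sphere2) :
    cosDist northPole y = (y : EuclideanSpace ℝ (Fin 3)) 2 := by
  simp [cosDist, northPole, EuclideanSpace.inner_single_left]

theorem integral_Ioi_pow_mul_exp_neg_sq (n : ℕ) :
    ∫ t in Set.Ioi (0 : ℝ), t ^ n * Real.exp (-t ^ 2) = 1 / 2 * Real.Gamma ((n + 1) / 2) := by
  have h := integral_rpow_mul_exp_neg_rpow (p := 2) (q := n) (by norm_num)
    (lt_of_lt_of_le (by norm_num) (Nat.cast_nonneg n))
  rw [← h]
  refine setIntegral_congr_fun measurableSet_Ioi fun t _ => ?_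
  simp

/-- Polar coordinates for a product of a homogeneous function with a Gaussian. -/
theorem integral_pow_mul_exp_neg_norm_sq (n : ℕ) :
    ∫ v : EuclideanSpace ℝ (Fin 3), v 2 ^ n * Real.exp (-‖v‖ ^ 2) =
      (∫ y : Sphere2, (y : EuclideanSpace ℝ (Fin 3)) 2 ^ n ∂sphereMeasure) *
        ∫ t in Set.Ioi (0 : ℝ), t ^ (n + 2) * Real.exp (-t ^ 2) := by
  set G : EuclideanSpace ℝ (Fin 3) → ℝ := fun v => v 2 ^ n * Real.exp (-‖v‖ ^ 2) with hG
  calc ∫ v, G v = ∫ v : ({0}ᶜ : Set (EuclideanSpace ℝ (Fin 3))), G v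
        ∂(volume.comap Subtype.val) := by
        rw [integral_subtype_comap (measurableSet_singleton _).compl G, restrict_compl_singleton]
    _ = ∫ z : Sphere2 × Set.Ioi (0 : ℝ), ((z.1 : EuclideanSpace ℝ (Fin 3)) 2 ^ n) *
          ((z.2 : ℝ) ^ n * Real.exp (-(z.2 : ℝ) ^ 2)) ∂sphereMeasure.prod (.volumeIoiPow 2) := by
        have h := (Measure.measurePreserving_homeomorphUnitSphereProd
          (volume : Measure (EuclideanSpace ℝ (Fin 3)))).integral_comp
          (Homeomorph.measurableEmbedding _)
          (fun z : Sphere2 × Set.Ioi (0 : ℝ) => ((z.1 : EuclideanSpace ℝ (Fin 3)) 2 ^ n) *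
          ((z.2 : ℝ) ^ n * Real.exp (-(z.2 : ℝ) ^ 2)))
        rw [finrank_euclideanSpace_fin] at h
        rw [sphereMeasure, ← h]
        refine integral_congr_ae (Filter.Eventually.of_forall fun v => ?_)
        have hv : ‖(v : EuclideanSpace ℝ (Fin 3))‖ ≠ 0 := norm_ne_zero_iff.mpr v.2
        simp only [hG, homeomorphUnitSphereProd_apply_fst_coe,
          homeomorphUnitSphereProd_apply_snd_coe, PiLp.smul_apply, smul_eq_mul]
        rw [← mul_assoc, ← mul_pow]
        congr 2
        field_simp
    _ = _ := by
        rw [integral_prod_mul (fun y : Sphere2 => (y : EuclideanSpace ℝ (Fin 3)) 2 ^ n)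
          (fun t : Set.Ioi (0 : ℝ) => (t : ℝ) ^ n * Real.exp (-(t : ℝ) ^ 2))]
        congr 1
        simp only [Measure.volumeIoiPow, ENNReal.ofReal]
        rw [integral_withDensity_eq_integral_smul,
          integral_subtype_comap measurableSet_Ioi
            fun a => Real.toNNReal (a ^ 2) • (a ^ n * Real.exp (-a ^ 2))]
        · refine setIntegral_congr_fun measurableSet_Ioi fun t _ => ?_
          simp only [NNReal.smul_def, Real.coe_toNNReal _ (sq_nonneg t), smul_eq_mul]
          ring
        · exact (measurable_subtype_coe.pow_const _).real_toNNReal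

/-- The same Gaussian integral in Cartesian coordinates, where it factors; comparison with polar
coordinates yields the moments of a coordinate on the sphere. -/
theorem integral_pow_mul_exp_neg_norm_sq_of_even {n : ℕ} (hn : Even n) :
    ∫ v : EuclideanSpace ℝ (Fin 3), v 2 ^ n * Real.exp (-‖v‖ ^ 2) =
      Real.pi * Real.Gamma ((n + 1) / 2) := by
  have h := (EuclideanSpace.volume_preserving_symm_measurableEquiv_toLp (Fin 3)).integral_comp'
    (g := fun v : Fin 3 → ℝ => ∏ i, ((if i = 2 then v i ^ n else 1) * Real.exp (-v i ^ 2)))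
  have h1 : ∫ v : EuclideanSpace ℝ (Fin 3), v 2 ^ n * Real.exp (-‖v‖ ^ 2) =
      ∫ v : Fin 3 → ℝ, ∏ i, ((if i = 2 then v i ^ n else 1) * Real.exp (-v i ^ 2)) := by
    rw [← h]
    refine integral_congr_ae (Filter.Eventually.of_forall fun v => ?_)
    simp only [Fin.prod_univ_three, EuclideanSpace.norm_sq_eq, Fin.sum_univ_three,
      Real.norm_eq_abs, sq_abs, neg_add, Real.exp_add]
    simp
    ring
  have h2 : ∫ t : ℝ, Real.exp (-t ^ 2) = √Real.pi := by simpa using integral_gaussian 1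
  have h3 : ∫ t : ℝ, t ^ n * Real.exp (-t ^ 2) = Real.Gamma ((n + 1) / 2) := by
    have := integral_comp_abs (f := fun t => t ^ n * Real.exp (-t ^ 2))
    rw [integral_Ioi_pow_mul_exp_neg_sq] at this
    simp only [sq_abs, hn.pow_abs] at this
    rw [this]
    ring
  rw [h1, integral_fintype_prod_volume_eq_prod
    (fun (i : Fin 3) (t : ℝ) => (if i = 2 then t ^ n else 1) * Real.exp (-t ^ 2)),
    Fin.prod_univ_three]
  simp only [Fin.reduceEq, if_false, if_true, one_mul, h2, h3,
    Real.mul_self_sqrt Real.pi_pos.le]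

/-- For even n the two evaluations of the Gaussian integral and Γ(s+1) = s Γ(s) leave 4π/(n+1); odd
moments vanish under the antipodal map. -/
theorem integral_cosDist_northPole_pow (n : ℕ) :
    ∫ y, cosDist northPole y ^ n ∂sphereMeasure = 2 * Real.pi * ∫ t in (-1 : ℝ)..1, t ^ n := by
  rw [integral_pow]
  rcases Nat.even_or_odd n with hn | hn
  · have h := (integral_pow_mul_exp_neg_norm_sq n).symm.trans
      (integral_pow_mul_exp_neg_norm_sq_of_even hn)
    rw [integral_Ioi_pow_mul_exp_neg_sq] at h
    have hG : Real.Gamma (((n + 2 : ℕ) + 1) / 2) =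
        ((n + 1) / 2) * Real.Gamma ((n + 1) / 2) := by
      rw [← Real.Gamma_add_one (by positivity)]
      congr 1; push_cast; ring
    have hpos : 0 < Real.Gamma ((n + 1) / 2) := Real.Gamma_pos_of_pos (by positivity)
    rw [hG] at h
    simp only [cosDist_northPole]
    rw [hn.add_one.neg_one_pow]
    have hn1 : (n + 1 : ℝ) ≠ 0 := by positivity
    field_simp at h ⊢
    norm_num
    linarith
  · have h := integral_comp_isometryAct (LinearIsometryEquiv.neg ℝ)
      (fun y => cosDist northPole y ^ n)
    have h2 : ∀ y, cosDist northPole (isometryAct (LinearIsometryEquiv.neg ℝ) y) ^ n =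
        - cosDist northPole y ^ n := by
      intro y
      rw [← hn.neg_pow]
      simp [cosDist_northPole, isometryAct]
    simp only [h2, integral_neg] at h
    rw [hn.add_one.neg_one_pow]
    simp
    linarith

/-- Archimedes: `⟨x, ·⟩` is uniformly distributed on `[-1, 1]`. -/
theorem integral_eval_cosDist (q : Polynomial ℝ) (x : Sphere2) :
    ∫ y, q.eval (cosDist x y) ∂sphereMeasure = 2 * Real.pi * ∫ t in (-1 : ℝ)..1, q.eval t := by
  obtain ⟨g, -, hg⟩ := exists_isRotation_isometryAct_eq northPole x
  have h : ∫ y, q.eval (cosDist x y) ∂sphereMeasure =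
      ∫ y, q.eval (cosDist northPole y) ∂sphereMeasure := by
    rw [← integral_comp_isometryAct g, ← hg]
    simp only [cosDist_isometryAct]
  rw [h]
  simp only [Polynomial.eval_eq_sum_range]
  rw [integral_finsetSum, intervalIntegral.integral_finsetSum, Finset.mul_sum]
  · refine Finset.sum_congr rfl fun n _ => ?_
    rw [integral_const_mul, intervalIntegral.integral_const_mul, integral_cosDist_northPole_pow]
    ring
  · intro n _
    exact (Continuous.intervalIntegrable (by fun_prop) _ _)
  · intro n _
    have := integrable_mul_of_continuous (f := fun _ => q.coeff n) (integrable_const _)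
      ((continuous_cosDist.comp (Continuous.prodMk_right northPole)).pow n)
    exact this

/-! ### The convolution of zonal polynomials -/

theorem zonalConv_eval_isometryAct (p q : Polynomial ℝ)
    (g : EuclideanSpace ℝ (Fin 3) ≃ₗᵢ[ℝ] EuclideanSpace ℝ (Fin 3)) (x y : Sphere2) :
    zonalConv q (fun e => p.eval (cosDist (isometryAct g x) e)) (isometryAct g y) =
      zonalConv q (fun e => p.eval (cosDist x e)) y := by
  rw [zonalConv, ← integral_comp_isometryAct g]
  simp only [cosDist_isometryAct]
  rfl

theorem zonalConv_eval_comm (p q : Polynomial ℝ) (x y : Sphere2) :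
    zonalConv q (fun e => p.eval (cosDist x e)) y =
      zonalConv p (fun e => q.eval (cosDist y e)) x := by
  simp only [zonalConv, mul_comm]

theorem integrable_eval_cosDist (p : Polynomial ℝ) (x : Sphere2) :
    Integrable (fun y => p.eval (cosDist x y)) sphereMeasure := by
  simpa using integrable_mul_of_continuous (integrable_const (1 : ℝ)) (continuous_eval_cosDist p x)

/-- Orthonormal pairs with the same first vector are related by an isometry. -/
theorem exists_isometryAct_eq_of_cosDist_eq_zero {x v w : Sphere2} (hv : cosDist x v = 0)
    (hw : cosDist x w = 0) :
    ∃ g : EuclideanSpace ℝ (Fin 3) ≃ₗᵢ[ℝ] EuclideanSpace ℝ (Fin 3),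
      isometryAct g x = x ∧ isometryAct g v = w := by
  refine ⟨(ℝ ∙ ((v : EuclideanSpace ℝ (Fin 3)) - w))ᗮ.reflection, Subtype.ext ?_, Subtype.ext ?_⟩
  · refine Submodule.reflection_mem_subspace_eq_self ?_
    rw [Submodule.mem_orthogonal_singleton_iff_inner_left, inner_sub_right]
    exact sub_eq_zero.mpr (hv.trans hw.symm)
  · exact Submodule.reflection_sub (by simp)

/-- Put y = t x + √(1-t²) w and expand q(⟨y, e⟩). The resulting moments do not depend on w, since an
isometry fixing x carries any orthogonal w to any other, and those odd in w vanish on replacing w by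
-w. Only even powers of √(1-t²) remain, so the result is a polynomial in t. -/
theorem exists_zonalConv_eval_eq_eval_of_fixed (p q : Polynomial ℝ) (x : Sphere2) :
    ∃ r : Polynomial ℝ, r.natDegree ≤ q.natDegree ∧ ∀ y,
      zonalConv q (fun e => p.eval (cosDist x e)) y = r.eval (cosDist x y) := by
  obtain ⟨w₀, hw₀⟩ := x.exists_cosDist_eq_zero
  set I : ℕ → ℕ → ℝ := fun a b => ∫ e, p.eval (cosDist x e) *
    (cosDist x e ^ a * cosDist w₀ e ^ b) ∂sphereMeasure with hI
  have hIw : ∀ w, cosDist x w = 0 → ∀ a b, ∫ e, p.eval (cosDist x e) *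
    (cosDist x e ^ a * cosDist w e ^ b) ∂sphereMeasure = I a b := by
    intro w hw a b
    obtain ⟨g, hgx, hgw⟩ := exists_isometryAct_eq_of_cosDist_eq_zero hw₀ hw
    rw [← integral_comp_isometryAct g]
    have h1 : ∀ e, cosDist x (isometryAct g e) = cosDist x e := fun e => by
      conv_lhs => rw [← hgx]
      exact cosDist_isometryAct g x e
    have h2 : ∀ e, cosDist w (isometryAct g e) = cosDist w₀ e := fun e => by
      rw [← hgw, cosDist_isometryAct]
    simp only [h1, h2, hI]
  have hodd : ∀ a b, Odd b → I a b = 0 := by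
    intro a b hb
    have hneg : cosDist x (isometryAct (LinearIsometryEquiv.neg ℝ) w₀) = 0 := by
      have : inner ℝ (x : EuclideanSpace ℝ (Fin 3)) w₀ = 0 := hw₀
      simp [cosDist, isometryAct, this]
    have h := hIw _ hneg a b
    have h2 : ∀ e, cosDist (isometryAct (LinearIsometryEquiv.neg ℝ) w₀) e = - cosDist w₀ e := by
      intro e; simp [cosDist, isometryAct]
    simp only [h2, hb.neg_pow, mul_neg, integral_neg] at h
    change - I a b = I a b at h
    linarith
  refine ⟨∑ n ∈ Finset.range (q.natDegree + 1), ∑ k ∈ Finset.range (n + 1),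
    Polynomial.C (q.coeff n * n.choose k * I k (n - k)) *
      (Polynomial.X ^ k * (1 - Polynomial.X ^ 2) ^ ((n - k) / 2)), ?_, fun y => ?_⟩
  · refine Polynomial.natDegree_sum_le_of_forall_le _ _ fun n hn =>
      Polynomial.natDegree_sum_le_of_forall_le _ _ fun k hk => ?_
    simp only [Finset.mem_range] at hn hk
    refine (Polynomial.natDegree_C_mul_le _ _).trans (Polynomial.natDegree_mul_le.trans ?_)
    rw [Polynomial.natDegree_X_pow]
    have h1 : ((1 : Polynomial ℝ) - Polynomial.X ^ 2).natDegree ≤ 2 := by compute_degree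
    have h2 := Polynomial.natDegree_pow_le_of_le ((n - k) / 2) h1
    omega
  · obtain ⟨w, hw, hy⟩ := x.exists_eq_cosDist_smul_add y
    set t := cosDist x y with ht
    have ht1 : 0 ≤ 1 - t ^ 2 := by
      have := abs_cosDist_le_one x y
      rw [← ht, ← sq_le_one_iff_abs_le_one] at this
      linarith
    have hye : ∀ e, cosDist y e = t * cosDist x e + √(1 - t ^ 2) * cosDist w e := by
      intro e
      simp [cosDist, hy, inner_add_left, inner_smul_left]
    have hcx : Continuous fun e => cosDist x e :=
      continuous_cosDist.comp (Continuous.prodMk_right x)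
    have hcw : Continuous fun e => cosDist w e :=
      continuous_cosDist.comp (Continuous.prodMk_right w)
    have hint : ∀ a b : ℕ, Integrable (fun e => p.eval (cosDist x e) *
        (cosDist x e ^ a * cosDist w e ^ b)) sphereMeasure := fun a b =>
      integrable_mul_of_continuous (integrable_eval_cosDist p x) (by fun_prop)
    have hpt : ∀ e, p.eval (cosDist x e) * q.eval (cosDist y e) =
        ∑ n ∈ Finset.range (q.natDegree + 1), ∑ k ∈ Finset.range (n + 1),
          (q.coeff n * n.choose k * (t ^ k * √(1 - t ^ 2) ^ (n - k))) *
            (p.eval (cosDist x e) * (cosDist x e ^ k * cosDist w e ^ (n - k))) := by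
      intro e
      rw [Polynomial.eval_eq_sum_range (p := q), Finset.mul_sum]
      refine Finset.sum_congr rfl fun n _ => ?_
      rw [hye, add_pow, Finset.mul_sum, Finset.mul_sum]
      refine Finset.sum_congr rfl fun k _ => ?_
      rw [mul_pow, mul_pow]
      ring
    simp only [zonalConv, hpt]
    rw [integral_finsetSum _ fun n _ => integrable_finsetSum _ fun k _ => (hint _ _).const_mul _,
      Polynomial.eval_finsetSum]
    refine Finset.sum_congr rfl fun n _ => ?_
    rw [integral_finsetSum _ fun k _ => (hint _ _).const_mul _, Polynomial.eval_finsetSum]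
    refine Finset.sum_congr rfl fun k _ => ?_
    rw [integral_const_mul, hIw w hw]
    rcases Nat.even_or_odd (n - k) with h | h
    · have : √(1 - t ^ 2) ^ (n - k) = (1 - t ^ 2) ^ ((n - k) / 2) := by
        conv_lhs => rw [← Nat.two_mul_div_two_of_even h, pow_mul, Real.sq_sqrt ht1]
      rw [this]
      simp
      ring
    · rw [hodd _ _ h]
      simp

theorem exists_cosDist_eq (x : Sphere2) {t : ℝ} (ht : t ∈ Set.Icc (-1 : ℝ) 1) :
    ∃ y, cosDist x y = t := by
  obtain ⟨w, hw⟩ := x.exists_cosDist_eq_zero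
  refine ⟨greatCircle x w hw (Real.arccos t), ?_⟩
  rw [cosDist_comm, cosDist_greatCircle, cosDist_self, cosDist_comm w,
    Real.cos_arccos ht.1 ht.2, hw]
  ring

theorem Polynomial.eq_of_eval_cosDist_eq {p q : Polynomial ℝ} (x : Sphere2)
    (h : ∀ y, p.eval (cosDist x y) = q.eval (cosDist x y)) : p = q := by
  refine Polynomial.eq_of_infinite_eval_eq p q
    ((Set.Icc_infinite (by norm_num : (-1 : ℝ) < 1)).mono fun t ht => ?_)
  obtain ⟨y, rfl⟩ := exists_cosDist_eq x ht
  exact h y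

/-- The convolution of two zonal polynomials is a zonal polynomial. -/
theorem exists_zonalConv_eval_eq_eval (p q : Polynomial ℝ) :
    ∃ r : Polynomial ℝ, r.natDegree ≤ p.natDegree ∧ r.natDegree ≤ q.natDegree ∧ ∀ x y,
      zonalConv q (fun e => p.eval (cosDist x e)) y = r.eval (cosDist x y) := by
  have key : ∀ p q : Polynomial ℝ, ∃ r : Polynomial ℝ, r.natDegree ≤ q.natDegree ∧ ∀ x y,
      zonalConv q (fun e => p.eval (cosDist x e)) y = r.eval (cosDist x y) := by
    intro p q
    obtain ⟨r, hr, h⟩ := exists_zonalConv_eval_eq_eval_of_fixed p q northPole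
    refine ⟨r, hr, fun x y => ?_⟩
    obtain ⟨g, -, hg⟩ := exists_isRotation_isometryAct_eq x northPole
    rw [← zonalConv_eval_isometryAct p q g, ← cosDist_isometryAct g x y, hg, h]
  obtain ⟨r, hr, h⟩ := key p q
  obtain ⟨r', hr', h'⟩ := key q p
  -- Convolution is symmetric in the two kernels, so a single polynomial inherits both degree
  -- bounds.
  have : r = r' := Polynomial.eq_of_eval_cosDist_eq northPole fun y => by
    rw [← h, zonalConv_eval_comm, h', cosDist_comm]
  exact ⟨r, this ▸ hr', hr, h⟩

/-- Fubini for triple products of zonal polynomials. -/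
theorem integral_zonalConv_mul_eval (p q s : Polynomial ℝ) (z : Sphere2) :
    ∫ y, zonalConv q (fun e => p.eval (cosDist z e)) y * s.eval (cosDist z y) ∂sphereMeasure =
      ∫ e, zonalConv q (fun y => s.eval (cosDist z y)) e * p.eval (cosDist z e)
        ∂sphereMeasure := by
  simp only [zonalConv, ← integral_mul_const]
  rw [integral_integral_swap]
  · simp only [cosDist_comm]
    refine integral_congr_ae (Filter.Eventually.of_forall fun e => ?_)
    refine integral_congr_ae (Filter.Eventually.of_forall fun y => ?_)
    simp only
    ring
  · have hc : Continuous fun u : Sphere2 × Sphere2 =>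
        p.eval (cosDist z u.2) * q.eval (cosDist u.1 u.2) * s.eval (cosDist z u.1) := by
      have h1 : Continuous fun u : Sphere2 × Sphere2 => cosDist z u.2 :=
        continuous_cosDist.comp (continuous_const.prodMk continuous_snd)
      have h2 : Continuous fun u : Sphere2 × Sphere2 => cosDist z u.1 :=
        continuous_cosDist.comp (continuous_const.prodMk continuous_fst)
      exact ((p.continuous.comp h1).mul (q.continuous.comp continuous_cosDist)).mul
        (s.continuous.comp h2)
    obtain ⟨M, hM⟩ := isCompact_univ.exists_bound_of_continuousOn hc.continuousOn
    exact Integrable.of_bound hc.aestronglyMeasurable M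
      (Filter.Eventually.of_forall fun u => hM u trivial)

theorem integral_eval_mul_eval_cosDist (p q : Polynomial ℝ) (x : Sphere2) :
    ∫ y, p.eval (cosDist x y) * q.eval (cosDist x y) ∂sphereMeasure =
      2 * Real.pi * ∫ t in (-1 : ℝ)..1, (p * q).eval t := by
  simp only [← Polynomial.eval_mul, integral_eval_cosDist]

/-- Fubini moves the kernel q from P_l onto s. The convolution of s with q has degree at most that
of s, hence is still orthogonal to P_l. -/
theorem integral_mul_eq_zero_of_zonalConv_legendrePoly {q r s : Polynomial ℝ} {l : ℕ}
    (h : ∀ x y, zonalConv q (fun e => (legendrePoly l).eval (cosDist x e)) y =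
      r.eval (cosDist x y)) (hs : s.natDegree < l) :
    ∫ t in (-1 : ℝ)..1, (r * s).eval t = 0 := by
  have h1 := integral_zonalConv_mul_eval (legendrePoly l) q s northPole
  obtain ⟨u, hu, -, hus⟩ := exists_zonalConv_eval_eq_eval s q
  simp only [h, hus] at h1
  rw [integral_eval_mul_eval_cosDist, integral_eval_mul_eval_cosDist, mul_comm u,
    integral_legendrePoly_mul_of_natDegree_lt (hu.trans_lt hs)] at h1
  have hpi := Real.pi_pos
  simpa [hpi.ne'] using h1

/-- By symmetry m < l. The convolution is then a polynomial r of degree below l, so r is orthogonal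
to itself. -/
theorem zonalConv_legendrePoly_of_ne {l m : ℕ} (hlm : l ≠ m) (x y : Sphere2) :
    zonalConv (legendrePoly m) (fun e => (legendrePoly l).eval (cosDist x e)) y = 0 := by
  wlog h : m < l generalizing l m x y
  · rw [zonalConv_eval_comm]
    exact this hlm.symm _ _ (by omega)
  obtain ⟨r, -, hr, hrs⟩ := exists_zonalConv_eval_eq_eval (legendrePoly l) (legendrePoly m)
  have h0 := integral_mul_eq_zero_of_zonalConv_legendrePoly hrs
    ((hr.trans (natDegree_legendrePoly_le m)).trans_lt h)
  rw [hrs, Polynomial.eq_zero_of_integral_mul_self_eq_zero h0, Polynomial.eval_zero]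

/-- This replaces the addition theorem. Subtracting from r the multiple of P_l with the same
coefficient of degree l leaves a polynomial of lower degree orthogonal to itself, hence zero. The
factor is found at x = y from the norm of P_l. -/
theorem zonalConv_legendrePoly_self (l : ℕ) (x y : Sphere2) :
    zonalConv (legendrePoly l) (fun e => (legendrePoly l).eval (cosDist x e)) y =
      4 * Real.pi / (2 * l + 1) * (legendrePoly l).eval (cosDist x y) := by
  obtain ⟨r, -, hr, hrs⟩ := exists_zonalConv_eval_eq_eval (legendrePoly l) (legendrePoly l)
  set c := r.coeff l / (legendrePoly l).coeff l with hc
  set d := r - Polynomial.C c * legendrePoly l with hd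
  have hdeg : d.natDegree ≤ l :=
    (Polynomial.natDegree_sub_le _ _).trans (max_le (hr.trans (natDegree_legendrePoly_le l))
      ((Polynomial.natDegree_C_mul_le _ _).trans (natDegree_legendrePoly_le l)))
  have hcoeff : d.coeff l = 0 := by
    rw [hd, Polynomial.coeff_sub, Polynomial.coeff_C_mul, hc,
      div_mul_cancel₀ _ (coeff_legendrePoly_ne_zero l), sub_self]
  have hd0 : d = 0 := by
    rcases Polynomial.natDegree_lt_or_eq_zero_of_coeff_eq_zero hdeg hcoeff with h | h
    · apply Polynomial.eq_zero_of_integral_mul_self_eq_zero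
      have h1 := integral_mul_eq_zero_of_zonalConv_legendrePoly hrs h
      have h2 := integral_legendrePoly_mul_of_natDegree_lt h
      have h3 : d * d = r * d - Polynomial.C c * (legendrePoly l * d) := by
        conv_lhs => enter [1]; rw [hd]
        ring
      rw [h3]
      simp only [Polynomial.eval_sub, Polynomial.eval_C_mul]
      rw [intervalIntegral.integral_sub (Polynomial.intervalIntegrable_eval _ _ _)
        ((Polynomial.intervalIntegrable_eval _ _ _).const_mul _),
        intervalIntegral.integral_const_mul, h1, h2, mul_zero, sub_zero]
    · exact h
  have hrc : r = Polynomial.C c * legendrePoly l := sub_eq_zero.mp hd0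
  have hc' : c = 4 * Real.pi / (2 * l + 1) := by
    have h1 := hrs northPole northPole
    rw [hrc, Polynomial.eval_C_mul, cosDist_self, eval_one_legendrePoly, zonalConv,
      integral_eval_mul_eval_cosDist, integral_legendrePoly_sq] at h1
    rw [← mul_one c, ← h1]
    ring
  rw [hrs, hrc, Polynomial.eval_C_mul, hc']

/-! ### Completeness of the Legendre convolutions -/

/-- A function whose convolutions with all Legendre polynomials vanish has vanishing convolutions
with all zonal polynomials. -/
theorem zonalConv_eq_zero_of_zonalConv_legendrePoly {f : Sphere2 → ℝ}
    (hf : Integrable f sphereMeasure) (h : ∀ l x, zonalConv (legendrePoly l) f x = 0)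
    (q : Polynomial ℝ) (x : Sphere2) : zonalConv q f x = 0 := by
  have hint : ∀ p : Polynomial ℝ, Integrable (fun y => f y * p.eval (cosDist x y))
      sphereMeasure := fun p => integrable_mul_of_continuous hf (continuous_eval_cosDist p x)
  suffices key : ∀ n, ∀ q : Polynomial ℝ, q.natDegree < n → zonalConv q f x = 0 from
    key _ q (Nat.lt_succ_self _)
  intro n
  induction n with
  | zero => intro q hq; omega
  | succ n ih =>
    intro q hq
    set c := q.coeff n / (legendrePoly n).coeff n with hc
    set d := q - Polynomial.C c * legendrePoly n with hd
    have hdeg : d.natDegree ≤ n :=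
      (Polynomial.natDegree_sub_le _ _).trans (max_le (by omega)
        ((Polynomial.natDegree_C_mul_le _ _).trans (natDegree_legendrePoly_le n)))
    have hcoeff : d.coeff n = 0 := by
      rw [hd, Polynomial.coeff_sub, Polynomial.coeff_C_mul, hc,
        div_mul_cancel₀ _ (coeff_legendrePoly_ne_zero n), sub_self]
    have hd0 : zonalConv d f x = 0 := by
      rcases Polynomial.natDegree_lt_or_eq_zero_of_coeff_eq_zero hdeg hcoeff with h | h
      · exact ih d h
      · simp [h, zonalConv]
    have hq' : q = d + Polynomial.C c * legendrePoly n := by rw [hd]; ring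
    have h1 : zonalConv q f x = zonalConv d f x + c * zonalConv (legendrePoly n) f x := by
      simp only [zonalConv]
      rw [← integral_const_mul, ← integral_add (hint _) ((hint _).const_mul _)]
      refine integral_congr_ae (Filter.Eventually.of_forall fun y => ?_)
      simp only [hq', Polynomial.eval_add, Polynomial.eval_C_mul]
      ring
    rw [h1, hd0, h, mul_zero, add_zero]

/-- Every term of the exponential series is a convolution with a monomial kernel; ‖f‖₁ |r|^n / n!
dominates and permits termwise integration. -/
theorem integral_mul_cexp_eq_zero_of_zonalConv_eq_zero {f : Sphere2 → ℝ}
    (hf : Integrable f sphereMeasure) (h : ∀ q x, zonalConv q f x = 0) (x : Sphere2) (r : ℝ) :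
    ∫ y, (f y : ℂ) * Complex.exp ((r * cosDist x y : ℝ) * Complex.I) ∂sphereMeasure = 0 := by
  set F : ℕ → Sphere2 → ℂ := fun n y =>
    (f y : ℂ) * (((r * cosDist x y : ℝ) * Complex.I) ^ n / (n.factorial : ℂ)) with hF
  have hFeq : ∀ n y, F n y = ((r * Complex.I) ^ n / (n.factorial : ℂ)) *
      ((f y * cosDist x y ^ n : ℝ) : ℂ) := by
    intro n y
    simp only [hF]
    push_cast
    rw [mul_right_comm (r : ℂ), mul_pow]
    ring
  have hpow : ∀ n : ℕ, Integrable (fun y => f y * cosDist x y ^ n) sphereMeasure := fun n =>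
    integrable_mul_of_continuous hf
      ((continuous_cosDist.comp (Continuous.prodMk_right x)).pow n)
  have hFint : ∀ n, Integrable (F n) sphereMeasure := by
    intro n
    rw [show F n = _ from funext (hFeq n)]
    exact (hpow n).ofReal.const_mul _
  have hF0 : ∀ n, ∫ y, F n y ∂sphereMeasure = 0 := by
    intro n
    simp only [hFeq]
    rw [integral_const_mul, integral_complex_ofReal]
    have := h (Polynomial.X ^ n) x
    simp only [zonalConv, Polynomial.eval_pow, Polynomial.eval_X] at this
    rw [this]
    simp
  have hsum : Summable fun n => ∫ y, ‖F n y‖ ∂sphereMeasure := by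
    refine Summable.of_nonneg_of_le (fun n => integral_nonneg fun y => norm_nonneg _) (fun n => ?_)
      ((Real.summable_pow_div_factorial |r|).mul_left (∫ y, |f y| ∂sphereMeasure))
    rw [← integral_mul_const]
    refine integral_mono (hFint n).norm (hf.abs.mul_const _) fun y => ?_
    simp only [hF, norm_mul, norm_div, norm_pow, Complex.norm_I, mul_one, Complex.norm_real,
      Real.norm_eq_abs, Complex.norm_natCast]
    gcongr
    exact mul_le_of_le_one_right (abs_nonneg _) (abs_cosDist_le_one x y)
  have hts := (hasSum_integral_of_summable_integral_norm hFint hsum).tsum_eq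
  simp only [hF0, tsum_zero] at hts
  rw [hts]
  refine integral_congr_ae (Filter.Eventually.of_forall fun y => ?_)
  simp only [hF]
  rw [tsum_mul_left, Complex.exp_eq_exp_ℂ, NormedSpace.exp_eq_tsum_div]

/-- An integrable function on the sphere is determined by its convolutions with the Legendre
polynomials. -/
theorem ae_eq_zero_of_zonalConv_legendrePoly {f : Sphere2 → ℝ}
    (hf : Integrable f sphereMeasure) (h : ∀ l x, zonalConv (legendrePoly l) f x = 0) :
    f =ᵐ[sphereMeasure] 0 := by
  have h0 := integral_mul_cexp_eq_zero_of_zonalConv_eq_zero hf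
    (zonalConv_eq_zero_of_zonalConv_legendrePoly hf h)
  have hemb : MeasurableEmbedding
      (Subtype.val : Sphere2 → EuclideanSpace ℝ (Fin 3)) :=
    MeasurableEmbedding.subtype_coe Metric.isClosed_sphere.measurableSet
  have hm : ∀ {u : Sphere2 → ℝ}, Integrable u sphereMeasure →
      AEMeasurable (fun y => ENNReal.ofReal (u y)) sphereMeasure :=
    fun hu => hu.aestronglyMeasurable.aemeasurable.ennreal_ofReal
  have hfin : ∀ {u : Sphere2 → ℝ}, Integrable u sphereMeasure →
      IsFiniteMeasure (sphereMeasure.withDensity fun y => ENNReal.ofReal (u y)) :=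
    fun hu => isFiniteMeasure_withDensity_ofReal hu.2
  have := hfin hf
  have := hfin hf.neg
  have hexp : ∀ t : EuclideanSpace ℝ (Fin 3), Continuous fun y : Sphere2 =>
      Complex.exp ((inner ℝ (y : EuclideanSpace ℝ (Fin 3)) t : ℝ) * Complex.I) := fun t => by
    fun_prop
  have hexpint : ∀ {u : Sphere2 → ℝ}, Integrable u sphereMeasure →
      ∀ t : EuclideanSpace ℝ (Fin 3), Integrable (fun y : Sphere2 => (u y : ℂ) *
      Complex.exp ((inner ℝ (y : EuclideanSpace ℝ (Fin 3)) t : ℝ) * Complex.I))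
        sphereMeasure := fun hu t =>
    hu.ofReal.mul_bdd (c := 1) (hexp t).aestronglyMeasurable
      (Filter.Eventually.of_forall fun y => (Complex.norm_exp_ofReal_mul_I _).le)
  have hchar : ∀ {u : Sphere2 → ℝ}, Integrable u sphereMeasure →
      ∀ t, charFun ((sphereMeasure.withDensity fun y => ENNReal.ofReal (u y)).map Subtype.val) t =
        ∫ y : Sphere2, ((max (u y) 0 : ℝ) : ℂ) *
          Complex.exp ((inner ℝ (y : EuclideanSpace ℝ (Fin 3)) t : ℝ) * Complex.I)
          ∂sphereMeasure := by
    intro u hu t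
    rw [charFun_apply, hemb.integral_map, integral_withDensity_eq_integral_toReal_smul₀ (hm hu)
      (Filter.Eventually.of_forall fun y => ENNReal.ofReal_lt_top)]
    refine integral_congr_ae (Filter.Eventually.of_forall fun y => ?_)
    simp only [ENNReal.toReal_ofReal', Complex.real_smul]
  -- The measures f⁺σ and f⁻σ, pushed to ℝ³, have characteristic functions differing by ∫ f(y)
  -- e^(i⟨y,t⟩) dσ(y) = 0. So they coincide, which forces f⁺ = f⁻ almost everywhere.
  have heq : (sphereMeasure.withDensity fun y => ENNReal.ofReal (f y)).map Subtype.val =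
      (sphereMeasure.withDensity fun y => ENNReal.ofReal ((-f) y)).map
        (Subtype.val : Sphere2 → EuclideanSpace ℝ (Fin 3)) := by
    refine Measure.ext_of_charFun (funext fun t => ?_)
    rw [hchar hf, hchar hf.neg, ← sub_eq_zero,
      ← integral_sub (hexpint hf.pos_part t) (hexpint hf.neg.pos_part t)]
    obtain ⟨x, hx⟩ : ∃ x : Sphere2, t = ‖t‖ • (x : EuclideanSpace ℝ (Fin 3)) := by
      by_cases ht : t = 0
      · exact ⟨northPole, by simp [ht]⟩
      · refine ⟨⟨‖t‖⁻¹ • t, by simp [norm_smul, ht]⟩, ?_⟩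
        rw [smul_smul, mul_inv_cancel₀ (norm_ne_zero_iff.mpr ht), one_smul]
    rw [← h0 x ‖t‖]
    refine integral_congr_ae (Filter.Eventually.of_forall fun y => ?_)
    have hin : inner ℝ (y : EuclideanSpace ℝ (Fin 3)) t = ‖t‖ * cosDist x y := by
      conv_lhs => rw [hx, inner_smul_right]
      rw [cosDist_comm]; rfl
    simp only [hin, ← sub_mul, ← Complex.ofReal_sub, Pi.neg_apply]
    congr 2
    exact max_zero_sub_eq_self (f y)
  have heq' : (sphereMeasure.withDensity fun y => ENNReal.ofReal (f y)) =
      sphereMeasure.withDensity fun y => ENNReal.ofReal ((-f) y) := by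
    rw [← hemb.comap_map (sphereMeasure.withDensity fun y => ENNReal.ofReal (f y)), heq,
      hemb.comap_map]
  rw [withDensity_eq_iff_of_sigmaFinite (hm hf) (hm hf.neg)] at heq'
  filter_upwards [heq'] with y hy
  rcases le_total 0 (f y) with h | h
  · rw [Pi.neg_apply, ENNReal.ofReal_of_nonpos (neg_nonpos.mpr h), ENNReal.ofReal_eq_zero] at hy
    exact le_antisymm hy h
  · rw [Pi.neg_apply, ENNReal.ofReal_of_nonpos h, eq_comm, ENNReal.ofReal_eq_zero] at hy
    exact le_antisymm h (neg_nonpos.mp hy)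

/-! ### Moments of Gaussian variables -/

theorem MeasureTheory.MemLp.eLpNorm_two_eq_sqrt {Ω : Type*} [MeasurableSpace Ω] {P : Measure Ω}
    {X : Ω → ℝ} (hX : MemLp X 2 P) :
    eLpNorm X 2 P = ENNReal.ofReal (√(∫ ω, X ω ^ 2 ∂P)) := by
  rw [hX.eLpNorm_eq_integral_rpow_norm two_ne_zero ENNReal.ofNat_ne_top, Real.sqrt_eq_rpow]
  simp

/-- X has the law of √v ξ + m with ξ standard normal. Minkowski applies, and both √v and |m| are at
most the L² norm, so X need not be centred. -/
theorem ProbabilityTheory.HasGaussianLaw.eLpNorm_le {Ω : Type*} [MeasurableSpace Ω] {P : Measure Ω}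
    {X : Ω → ℝ} (hX : HasGaussianLaw X P) {p : ENNReal} (hp : 1 ≤ p) :
    eLpNorm X p P ≤ (1 + eLpNorm id p (gaussianReal 0 1)) * eLpNorm X 2 P := by
  have := hX.isProbabilityMeasure
  have h2 := hX.memLp_two
  set m := ∫ ω, X ω ∂P with hm
  set v := Var[X; P] with hv
  have hv0 : 0 ≤ v := variance_nonneg X P
  have hvm : ∫ ω, X ω ^ 2 ∂P = v + m ^ 2 := by
    rw [hv, variance_eq_sub h2]
    simp [hm]
  have hmap : P.map X = (gaussianReal 0 1).map (fun t => √v * t + m) := by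
    rw [hX.map_eq_gaussianReal]
    have h1 : (gaussianReal 0 1).map (fun t => √v * t + m) =
        ((gaussianReal 0 1).map (fun t => √v * t)).map (fun t => t + m) := by
      rw [Measure.map_map (by fun_prop) (by fun_prop)]; rfl
    rw [h1, gaussianReal_map_const_mul, gaussianReal_map_add_const]
    congr 1
    · simp [hm]
    · rw [← hv, mul_one]
      ext
      simp [Real.coe_toNNReal _ hv0, Real.sq_sqrt hv0]
  have hXp : eLpNorm X p P = eLpNorm (fun t => √v * t + m) p (gaussianReal 0 1) := by
    have h1 : eLpNorm id p (P.map X) = eLpNorm X p P :=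
      eLpNorm_map_measure aestronglyMeasurable_id hX.aemeasurable
    rw [← h1, hmap, eLpNorm_map_measure aestronglyMeasurable_id (by fun_prop)]
    rfl
  have hle : eLpNorm (fun t => √v * t + m) p (gaussianReal 0 1) ≤
      ENNReal.ofReal √v * eLpNorm id p (gaussianReal 0 1) + ENNReal.ofReal |m| := by
    refine (eLpNorm_add_le (f := fun t : ℝ => √v * t) (g := fun _ => m)
      (by fun_prop) (by fun_prop) hp).trans ?_
    have h1 : eLpNorm (fun t : ℝ => √v * t) p (gaussianReal 0 1) =
        ENNReal.ofReal √v * eLpNorm id p (gaussianReal 0 1) := by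
      have := eLpNorm_const_smul (√v) (id : ℝ → ℝ) p (gaussianReal 0 1)
      rw [Real.enorm_eq_ofReal (Real.sqrt_nonneg v)] at this
      exact this
    have h2 : eLpNorm (fun _ : ℝ => m) p (gaussianReal 0 1) = ENNReal.ofReal |m| := by
      rw [eLpNorm_const _ (by intro h; simp [h] at hp) (IsProbabilityMeasure.ne_zero _)]
      simp [Real.enorm_eq_ofReal_abs]
    rw [h1, h2]
  have h3 : √v ≤ √(∫ ω, X ω ^ 2 ∂P) := Real.sqrt_le_sqrt (by rw [hvm]; nlinarith)
  have h4 : |m| ≤ √(∫ ω, X ω ^ 2 ∂P) := by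
    rw [← Real.sqrt_sq_eq_abs]; exact Real.sqrt_le_sqrt (by rw [hvm]; linarith)
  rw [hXp, h2.eLpNorm_two_eq_sqrt, add_mul, one_mul, add_comm, mul_comm (eLpNorm id p _)]
  refine hle.trans ?_
  gcongr

/-! ### Linear functionals of an isotropic Gaussian field -/

/-- Nonnegativity of ∫ (g - a)² for a the mean of g. -/
theorem sq_integral_le {g : Sphere2 → ℝ} (hg : MemLp g 2 sphereMeasure) :
    (∫ y, g y ∂sphereMeasure) ^ 2 ≤
      sphereMeasure.real Set.univ * ∫ y, g y ^ 2 ∂sphereMeasure := by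
  have hint := hg.integrable one_le_two
  set s := sphereMeasure.real Set.univ with hs
  have hs0 : 0 < s := by
    have : sphereMeasure Set.univ ≠ 0 := by
      rw [Ne, Measure.measure_univ_eq_zero, sphereMeasure]
      exact Measure.toSphere_ne_zero _
    exact ENNReal.toReal_pos this (measure_ne_top _ _)
  set a := (∫ y, g y ∂sphereMeasure) / s with ha
  have h : 0 ≤ ∫ y, (g y - a) ^ 2 ∂sphereMeasure := integral_nonneg fun y => sq_nonneg _
  have h2 : ∫ y, (g y - a) ^ 2 ∂sphereMeasure =
      ∫ y, g y ^ 2 ∂sphereMeasure - 2 * a * ∫ y, g y ∂sphereMeasure + a ^ 2 * s := by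
    have : ∀ y, (g y - a) ^ 2 = g y ^ 2 - 2 * a * g y + a ^ 2 := fun y => by ring
    simp only [this]
    have h1 : Integrable (fun y => g y ^ 2 - 2 * a * g y) sphereMeasure :=
      hg.integrable_sq.sub (hint.const_mul _)
    rw [integral_add h1 (integrable_const _),
      integral_sub hg.integrable_sq (hint.const_mul _), integral_const_mul, integral_const,
      smul_eq_mul, mul_comm s]
  have h3 : ∫ y, g y ∂sphereMeasure = a * s := by rw [ha]; field_simp
  rw [h2, h3] at h
  rw [h3]
  nlinarith

namespace IsIsotropicGRF

variable {Ω : Type*} [MeasurableSpace Ω] {P : Measure Ω} {T : Ω → Sphere2 → ℝ}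

theorem memLp_two (hT : IsIsotropicGRF P T) (x : Sphere2) : MemLp (fun ω => T ω x) 2 P :=
  hT.isWeaklyIsotropic.1 x

theorem integral_mul_isometryAct (hT : IsIsotropicGRF P T)
    {g : EuclideanSpace ℝ (Fin 3) ≃ₗᵢ[ℝ] EuclideanSpace ℝ (Fin 3)} (hg : IsRotation g)
    (x y : Sphere2) :
    ∫ ω, T ω (isometryAct g x) * T ω (isometryAct g y) ∂P = ∫ ω, T ω x * T ω y ∂P := by
  simpa [Fin.prod_univ_two] using
    (hT.isWeaklyIsotropic.2 2 one_le_two le_rfl ![x, y] g hg).symm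

theorem integral_sq_eq (hT : IsIsotropicGRF P T) (x y : Sphere2) :
    ∫ ω, T ω x ^ 2 ∂P = ∫ ω, T ω y ^ 2 ∂P := by
  obtain ⟨g, hg, rfl⟩ := exists_isRotation_isometryAct_eq x y
  simpa [sq] using (hT.integral_mul_isometryAct hg x x).symm

theorem measurable_apply (hT : IsIsotropicGRF P T) (ω : Ω) : Measurable (T ω) :=
  hT.isRandomField.comp measurable_prodMk_left

theorem measurable_integral_mul (hT : IsIsotropicGRF P T) {f : Sphere2 → ℝ} (hf : Continuous f) :
    Measurable fun ω => ∫ y, T ω y * f y ∂sphereMeasure :=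
  ((hT.isRandomField.mul (hf.measurable.comp measurable_snd)).stronglyMeasurable.integral_prod_right
    ).measurable

variable [IsProbabilityMeasure P]

theorem memLp_two_prod (hT : IsIsotropicGRF P T) :
    MemLp (fun z : Ω × Sphere2 => T z.1 z.2) 2 (P.prod sphereMeasure) := by
  have hm : AEStronglyMeasurable (fun z : Ω × Sphere2 => T z.1 z.2) (P.prod sphereMeasure) :=
    hT.isRandomField.aestronglyMeasurable
  rw [memLp_two_iff_integrable_sq hm,
    integrable_prod_iff' (f := fun z : Ω × Sphere2 => T z.1 z.2 ^ 2) (hm.pow 2)]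
  refine ⟨Filter.Eventually.of_forall fun y => (hT.memLp_two y).integrable_sq, ?_⟩
  simp only [norm_pow, Real.norm_eq_abs, sq_abs]
  simp only [hT.integral_sq_eq _ northPole]
  exact integrable_const _

theorem ae_memLp_two (hT : IsIsotropicGRF P T) : ∀ᵐ ω ∂P, MemLp (T ω) 2 sphereMeasure := by
  have h := hT.memLp_two_prod.integrable_sq.prod_right_ae
  filter_upwards [h] with ω hω
  exact (memLp_two_iff_integrable_sq (hT.measurable_apply ω).aestronglyMeasurable).mpr hω

theorem ae_integrable (hT : IsIsotropicGRF P T) : ∀ᵐ ω ∂P, Integrable (T ω) sphereMeasure := by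
  filter_upwards [hT.ae_memLp_two] with ω hω
  exact hω.integrable one_le_two

theorem memLp_two_integral_mul (hT : IsIsotropicGRF P T) {f : Sphere2 → ℝ} (hf : Continuous f) :
    MemLp (fun ω => ∫ y, T ω y * f y ∂sphereMeasure) 2 P := by
  rw [memLp_two_iff_integrable_sq (hT.measurable_integral_mul hf).aestronglyMeasurable]
  obtain ⟨M, hM⟩ := isCompact_univ.exists_bound_of_continuousOn hf.continuousOn
  have hint : Integrable (fun ω => M ^ 2 * ∫ y, T ω y ^ 2 ∂sphereMeasure) P :=
    hT.memLp_two_prod.integrable_sq.integral_prod_left.const_mul _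
  refine (hint.const_mul (sphereMeasure.real Set.univ)).mono'
    ((hT.measurable_integral_mul hf).pow_const 2).aestronglyMeasurable ?_
  filter_upwards [hT.ae_memLp_two] with ω hω
  have hTf : MemLp (fun y => T ω y * f y) 2 sphereMeasure := by
    refine (hω.const_mul M).mono (hω.aestronglyMeasurable.mul hf.aestronglyMeasurable)
      (Filter.Eventually.of_forall fun y => ?_)
    rw [norm_mul, norm_mul, mul_comm]
    gcongr
    exact (hM y trivial).trans (le_abs_self M)
  rw [Real.norm_of_nonneg (sq_nonneg _)]
  refine (sq_integral_le hTf).trans ?_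
  rw [← integral_const_mul (M ^ 2)]
  gcongr ?_ * ?_
  refine integral_mono hTf.integrable_sq (hω.integrable_sq.const_mul _) fun y => ?_
  simp only
  rw [mul_pow, mul_comm]
  refine mul_le_mul_of_nonneg_right ?_ (sq_nonneg _)
  exact sq_le_sq' (abs_le.mp (hM y trivial)).1 (abs_le.mp (hM y trivial)).2

theorem integral_mul_integral_mul (hT : IsIsotropicGRF P T) {Z : Ω → ℝ} (hZ : MemLp Z 2 P)
    {f : Sphere2 → ℝ} (hf : Continuous f) :
    ∫ ω, Z ω * ∫ y, T ω y * f y ∂sphereMeasure ∂P =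
      ∫ y, (∫ ω, Z ω * T ω y ∂P) * f y ∂sphereMeasure := by
  have hint : Integrable (fun z : Ω × Sphere2 => Z z.1 * T z.1 z.2 * f z.2)
      (P.prod sphereMeasure) := by
    obtain ⟨M, hM⟩ := isCompact_univ.exists_bound_of_continuousOn hf.continuousOn
    have h1 : MemLp (fun z : Ω × Sphere2 => Z z.1) 2 (P.prod sphereMeasure) := hZ.comp_fst _
    exact (h1.integrable_mul hT.memLp_two_prod).mul_bdd (c := M)
      (hf.measurable.comp measurable_snd).aestronglyMeasurable
      (Filter.Eventually.of_forall fun z => hM _ trivial)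
  simp only [← integral_const_mul, ← integral_mul_const, ← mul_assoc]
  exact integral_integral_swap hint

/-- All moments of a linear functional of a Gaussian field are controlled by its second moment. -/
theorem eLpNorm_integral_mul_le (hT : IsIsotropicGRF P T) {f : Sphere2 → ℝ} (hf : Continuous f)
    {p : ENNReal} (hp : 1 ≤ p) :
    eLpNorm (fun ω => ∫ y, T ω y * f y ∂sphereMeasure) p P ≤
      (1 + eLpNorm id p (gaussianReal 0 1)) *
        eLpNorm (fun ω => ∫ y, T ω y * f y ∂sphereMeasure) 2 P := by
  set c := 1 + eLpNorm id p (gaussianReal 0 1) with hc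
  set L := (hT.memLp_two_integral_mul hf).toLp with hL
  set G : Submodule ℝ (Lp ℝ 2 P) :=
    Submodule.span ℝ (Set.range fun x => (hT.memLp_two x).toLp) with hG
  -- By Fubini, a variable orthogonal to every T(y) is orthogonal to ∫ T f dσ. So the functional is
  -- an L² limit of finite linear combinations of field values, which are Gaussian.
  have hmem : L ∈ G.topologicalClosure := by
    rw [← Submodule.orthogonal_orthogonal_eq_closure, Submodule.mem_orthogonal]
    intro Z hZ
    rw [L2.inner_def]
    have h1 : ∫ ω, inner ℝ (Z ω) (L ω) ∂P =
        ∫ ω, Z ω * ∫ y, T ω y * f y ∂sphereMeasure ∂P := by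
      refine integral_congr_ae ?_
      filter_upwards [(hT.memLp_two_integral_mul hf).coeFn_toLp] with ω hω
      rw [hω]
      simp [mul_comm]
    rw [h1, hT.integral_mul_integral_mul (Lp.memLp Z) hf]
    refine integral_eq_zero_of_ae (Filter.Eventually.of_forall fun y => ?_)
    have h2 := (Submodule.mem_orthogonal _ _).mp hZ _
      (Submodule.subset_span (Set.mem_range_self y))
    rw [L2.inner_def] at h2
    have h3 : ∫ ω, Z ω * T ω y ∂P = 0 := by
      rw [← h2]
      refine integral_congr_ae ?_
      filter_upwards [(hT.memLp_two y).coeFn_toLp] with ω hω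
      simp [hω]
    simp [h3]
  have hspan : ∀ Z ∈ G, eLpNorm Z p P ≤ c * eLpNorm Z 2 P := by
    intro Z hZ
    obtain ⟨a, rfl⟩ := Finsupp.mem_span_range_iff_exists_finsupp.mp hZ
    have hae : (a.sum fun x r => r • (hT.memLp_two x).toLp : Lp ℝ 2 P) =ᵐ[P]
        fun ω => ∑ x ∈ a.support, a x • T ω x := by
      rw [Finsupp.sum]
      refine (Lp.coeFn_finsetSum _ _).trans ?_
      have : ∀ᵐ ω ∂P, ∀ x ∈ a.support, (a x • (hT.memLp_two x).toLp : Lp ℝ 2 P) ω =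
          a x • T ω x := by
        rw [Filter.eventually_all_finset]
        intro x _
        filter_upwards [Lp.coeFn_smul (a x) (hT.memLp_two x).toLp,
          (hT.memLp_two x).coeFn_toLp] with ω h1 h2
        rw [h1, Pi.smul_apply, h2]
      filter_upwards [this] with ω hω
      rw [Finset.sum_apply]
      exact Finset.sum_congr rfl hω
    have hgauss : HasGaussianLaw (fun ω => ∑ x ∈ a.support, a x • T ω x) P :=
      (hT.isGaussian.smul a).hasGaussianLaw_fun_sum
    rw [eLpNorm_congr_ae hae, eLpNorm_congr_ae hae]
    exact hgauss.eLpNorm_le hp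
  obtain ⟨u, huG, hu⟩ := mem_closure_iff_seq_limit.mp
    (show L ∈ closure (G : Set (Lp ℝ 2 P)) from hmem)
  -- Along an almost surely convergent subsequence Fatou bounds the L^p norm of the limit, while the
  -- L² norms converge.
  have htm : TendstoInMeasure P (fun n => (u n : Ω → ℝ)) Filter.atTop L :=
    tendstoInMeasure_of_tendsto_Lp hu
  obtain ⟨ns, hns, hae⟩ := htm.exists_seq_tendsto_ae
  have hlim := Lp.eLpNorm_lim_le_liminf_eLpNorm (p := p)
    (fun n => (Lp.memLp (u (ns n))).aestronglyMeasurable) L hae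
  have hnorm : Filter.Tendsto (fun n => eLpNorm (u (ns n)) 2 P) Filter.atTop
      (nhds (eLpNorm L 2 P)) := by
    have h1 := (continuous_enorm.tendsto L).comp (hu.comp hns.tendsto_atTop)
    simp only [Lp.enorm_def] at h1
    exact h1
  have hLf := (hT.memLp_two_integral_mul hf).coeFn_toLp
  rw [← eLpNorm_congr_ae hLf, ← eLpNorm_congr_ae hLf]
  -- The constant may be infinite for p = ⊤; multiplication by it is then not continuous at 0, so
  -- this case is separate.
  by_cases hctop : c = ⊤
  · by_cases h0 : eLpNorm L 2 P = 0
    · have : L = 0 := by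
        rw [← Lp.enorm_def] at h0
        exact enorm_eq_zero.mp h0
      rw [eLpNorm_congr_ae (show (L : Ω → ℝ) =ᵐ[P] 0 by rw [this]; exact Lp.coeFn_zero _ _ _)]
      simp
    · rw [hctop]
      change _ ≤ ⊤ * eLpNorm L 2 P
      rw [ENNReal.top_mul h0]
      exact le_top
  · refine hlim.trans ?_
    refine (Filter.liminf_le_liminf (Filter.Eventually.of_forall fun n => hspan _ (huG _))).trans ?_
    exact (ENNReal.Tendsto.const_mul hnorm (Or.inr hctop)).liminf_eq.le

end IsIsotropicGRF

/-! ### Littlewood–Paley blocks -/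

theorem zonalConv_C_mul (c : ℝ) (q : Polynomial ℝ) (f : Sphere2 → ℝ) (x : Sphere2) :
    zonalConv (Polynomial.C c * q) f x = c * zonalConv q f x := by
  simp only [zonalConv, Polynomial.eval_C_mul]
  rw [← integral_const_mul]
  refine integral_congr_ae (Filter.Eventually.of_forall fun y => ?_)
  simp only
  ring

theorem zonalConv_add {f : Sphere2 → ℝ} (hf : Integrable f sphereMeasure) (p q : Polynomial ℝ)
    (x : Sphere2) : zonalConv (p + q) f x = zonalConv p f x + zonalConv q f x := by
  simp only [zonalConv, Polynomial.eval_add, mul_add]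
  exact integral_add (integrable_mul_of_continuous hf (continuous_eval_cosDist p x))
    (integrable_mul_of_continuous hf (continuous_eval_cosDist q x))

theorem zonalConv_sum {ι : Type*} {f : Sphere2 → ℝ} (hf : Integrable f sphereMeasure)
    (s : Finset ι) (q : ι → Polynomial ℝ) (x : Sphere2) :
    zonalConv (∑ i ∈ s, q i) f x = ∑ i ∈ s, zonalConv (q i) f x := by
  simp only [zonalConv, Polynomial.eval_finsetSum, Finset.mul_sum]
  exact integral_finsetSum _ fun i _ =>
    integrable_mul_of_continuous hf (continuous_eval_cosDist (q i) x)

/-- The reproducing kernel of the spherical harmonics of degree `l`. -/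
noncomputable def harmonicKernel (l : ℕ) : Polynomial ℝ :=
  Polynomial.C ((2 * l + 1) / (4 * Real.pi)) * legendrePoly l

/-- The reproducing kernel of the spherical harmonics of degree in `[2 ^ j, 2 ^ (j + 1))`. -/
noncomputable def blockKernel (j : ℕ) : Polynomial ℝ :=
  ∑ l ∈ Finset.Ico (2 ^ j) (2 ^ (j + 1)), harmonicKernel l

/-- The reproducing kernel of the spherical harmonics of degree less than `2 ^ J`. -/
noncomputable def partialKernel (J : ℕ) : Polynomial ℝ :=
  harmonicKernel 0 + ∑ j ∈ Finset.range J, blockKernel j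

theorem natDegree_harmonicKernel_le (l : ℕ) : (harmonicKernel l).natDegree ≤ l :=
  (Polynomial.natDegree_C_mul_le _ _).trans (natDegree_legendrePoly_le l)

theorem natDegree_blockKernel_le (j : ℕ) : (blockKernel j).natDegree ≤ 2 ^ (j + 1) :=
  Polynomial.natDegree_sum_le_of_forall_le _ _ fun l hl =>
    (natDegree_harmonicKernel_le l).trans (Finset.mem_Ico.mp hl).2.le

theorem partialKernel_eq_sum (J : ℕ) :
    partialKernel J = ∑ l ∈ Finset.range (2 ^ J), harmonicKernel l := by
  induction J with
  | zero => simp [partialKernel]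
  | succ J ih =>
    rw [partialKernel, Finset.sum_range_succ, ← add_assoc, ← partialKernel, ih, blockKernel,
      Finset.sum_range_add_sum_Ico _ (Nat.pow_le_pow_right two_pos J.le_succ)]

/-- The harmonic with m = 0 is zonal about the north pole, so a_{l0} is, up to normalisation, the
convolution with P_l at that point. -/
theorem sphHarm_zero (l : ℕ) (y : Sphere2) :
    sphHarm l 0 y = ((√((2 * l + 1) / (4 * Real.pi)) *
      (legendrePoly l).eval (cosDist northPole y) : ℝ) : ℂ) := by
  have hb := abs_le.mp (abs_cosDist_le_one northPole y)
  have hl : (l.factorial : ℝ) ≠ 0 := by positivity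
  rw [sphHarm, ← cosDist_northPole]
  simp [sphHarmAngular, sphHarmNat, assocLegendre, Real.cos_arccos hb.1 hb.2, hl]

theorem klCoeff_zero {Ω : Type*} (T : Ω → Sphere2 → ℝ) (l : ℕ) (ω : Ω) :
    klCoeff T l 0 ω = ((√((2 * l + 1) / (4 * Real.pi)) *
      zonalConv (legendrePoly l) (T ω) northPole : ℝ) : ℂ) := by
  rw [klCoeff, zonalConv, ← integral_const_mul, ← integral_complex_ofReal]
  refine integral_congr_ae (Filter.Eventually.of_forall fun y => ?_)
  simp only [sphHarm_zero, Complex.conj_ofReal]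
  push_cast
  ring

theorem zonalConv_harmonicKernel_northPole {Ω : Type*} (T : Ω → Sphere2 → ℝ) (l : ℕ) (ω : Ω) :
    ((zonalConv (harmonicKernel l) (T ω) northPole : ℝ) : ℂ) =
      ((√((2 * l + 1) / (4 * Real.pi)) : ℝ) : ℂ) * klCoeff T l 0 ω := by
  rw [klCoeff_zero, ← Complex.ofReal_mul, ← mul_assoc,
    Real.mul_self_sqrt (by positivity), harmonicKernel, zonalConv_C_mul]

namespace IsIsotropicGRF

variable {Ω : Type*} [MeasurableSpace Ω] {P : Measure Ω} {T : Ω → Sphere2 → ℝ}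

theorem integral_zonalConv_harmonicKernel_mul {A : ℕ → ℝ}
    (hA : IsAngularPowerSpectrum P T A) {l m : ℕ} (hl : 1 ≤ l) (hm : 1 ≤ m) :
    ∫ ω, zonalConv (harmonicKernel l) (T ω) northPole *
      zonalConv (harmonicKernel m) (T ω) northPole ∂P =
        if l = m then (2 * l + 1) / (4 * Real.pi) * A l else 0 := by
  have h := hA.covariance l m 0 0 hl hm (by simp) (by simp)
  apply Complex.ofReal_injective
  rw [← integral_complex_ofReal]
  have h2 : ∀ ω, ((zonalConv (harmonicKernel l) (T ω) northPole *
      zonalConv (harmonicKernel m) (T ω) northPole : ℝ) : ℂ) =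
      (((√((2 * l + 1) / (4 * Real.pi)) : ℝ) : ℂ) * ((√((2 * m + 1) / (4 * Real.pi)) : ℝ) : ℂ)) *
        (klCoeff T l 0 ω * (starRingEnd ℂ) (klCoeff T m 0 ω)) := by
    intro ω
    rw [Complex.ofReal_mul, zonalConv_harmonicKernel_northPole,
      zonalConv_harmonicKernel_northPole, klCoeff_zero T m, Complex.conj_ofReal]
    ring
  simp only [h2]
  rw [integral_const_mul, h]
  by_cases hlm : l = m
  · subst hlm
    simp only [and_self, if_true]
    rw [← Complex.ofReal_mul, Real.mul_self_sqrt (by positivity), ← Complex.ofReal_mul]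
  · simp [hlm]

theorem measurable_zonalConv (hT : IsIsotropicGRF P T) (q : Polynomial ℝ) :
    Measurable fun z : Ω × Sphere2 => zonalConv q (T z.1) z.2 := by
  have h1 : Measurable fun u : (Ω × Sphere2) × Sphere2 => T u.1.1 u.2 :=
    hT.isRandomField.comp ((measurable_fst.comp measurable_fst).prodMk measurable_snd)
  have h2 : Measurable fun u : (Ω × Sphere2) × Sphere2 => q.eval (cosDist u.1.2 u.2) :=
    (q.continuous.comp continuous_cosDist).measurable.comp
      ((measurable_snd.comp measurable_fst).prodMk measurable_snd)
  exact ((h1.mul h2).stronglyMeasurable.integral_prod_right).measurable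

variable [IsProbabilityMeasure P]

theorem memLp_two_zonalConv (hT : IsIsotropicGRF P T) (q : Polynomial ℝ) (x : Sphere2) :
    MemLp (fun ω => zonalConv q (T ω) x) 2 P :=
  hT.memLp_two_integral_mul (continuous_eval_cosDist q x)

theorem integral_mul_zonalConv (hT : IsIsotropicGRF P T) (q : Polynomial ℝ) (x z : Sphere2) :
    ∫ ω, T ω z * zonalConv q (T ω) x ∂P =
      ∫ y, (∫ ω, T ω z * T ω y ∂P) * q.eval (cosDist x y) ∂sphereMeasure :=
  hT.integral_mul_integral_mul (hT.memLp_two z) (continuous_eval_cosDist q x)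

theorem integral_mul_zonalConv_isometryAct (hT : IsIsotropicGRF P T) (q : Polynomial ℝ)
    {g : EuclideanSpace ℝ (Fin 3) ≃ₗᵢ[ℝ] EuclideanSpace ℝ (Fin 3)} (hg : IsRotation g)
    (x z : Sphere2) :
    ∫ ω, T ω (isometryAct g z) * zonalConv q (T ω) (isometryAct g x) ∂P =
      ∫ ω, T ω z * zonalConv q (T ω) x ∂P := by
  rw [hT.integral_mul_zonalConv, hT.integral_mul_zonalConv, ← integral_comp_isometryAct g]
  simp only [cosDist_isometryAct, hT.integral_mul_isometryAct hg]

/-- The second moment is a double integral of the covariance against the kernel; covariance, kernel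
and σ are all rotation invariant, and rotations act transitively. -/
theorem integral_zonalConv_sq_eq (hT : IsIsotropicGRF P T) (q : Polynomial ℝ) (x z : Sphere2) :
    ∫ ω, zonalConv q (T ω) x ^ 2 ∂P = ∫ ω, zonalConv q (T ω) z ^ 2 ∂P := by
  have h : ∀ x, ∫ ω, zonalConv q (T ω) x ^ 2 ∂P =
      ∫ y, (∫ ω, T ω y * zonalConv q (T ω) x ∂P) * q.eval (cosDist x y) ∂sphereMeasure := by
    intro x
    simp only [mul_comm (T _ _), sq]
    exact hT.integral_mul_integral_mul (hT.memLp_two_zonalConv q x) (continuous_eval_cosDist q x)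
  obtain ⟨g, hg, rfl⟩ := exists_isRotation_isometryAct_eq x z
  rw [h, h, ← integral_comp_isometryAct g
    (fun y => (∫ ω, T ω y * zonalConv q (T ω) (isometryAct g x) ∂P) * _)]
  simp only [cosDist_isometryAct, hT.integral_mul_zonalConv_isometryAct q hg]

/-- This carries L² convergence of the partial sums from one point of the sphere to all others. -/
theorem integral_sub_zonalConv_sq_eq (hT : IsIsotropicGRF P T) (q : Polynomial ℝ)
    (x z : Sphere2) :
    ∫ ω, (T ω x - zonalConv q (T ω) x) ^ 2 ∂P = ∫ ω, (T ω z - zonalConv q (T ω) z) ^ 2 ∂P := by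
  have h : ∀ x, ∫ ω, (T ω x - zonalConv q (T ω) x) ^ 2 ∂P = ∫ ω, T ω x ^ 2 ∂P -
      2 * ∫ ω, T ω x * zonalConv q (T ω) x ∂P + ∫ ω, zonalConv q (T ω) x ^ 2 ∂P := by
    intro x
    have h1 := (hT.memLp_two x).integrable_sq
    have h2 := (hT.memLp_two_zonalConv q x).integrable_sq
    have h3 : Integrable (fun ω => 2 * (T ω x * zonalConv q (T ω) x)) P :=
      ((hT.memLp_two x).integrable_mul (hT.memLp_two_zonalConv q x)).const_mul 2
    have h4 : Integrable (fun ω => T ω x ^ 2 - 2 * (T ω x * zonalConv q (T ω) x)) P := h1.sub h3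
    rw [← integral_const_mul, ← integral_sub h1 h3, ← integral_add h4 h2]
    refine integral_congr_ae (Filter.Eventually.of_forall fun ω => ?_)
    simp only
    ring
  obtain ⟨g, hg, rfl⟩ := exists_isRotation_isometryAct_eq x z
  rw [h, h, hT.integral_mul_zonalConv_isometryAct q hg, hT.integral_sq_eq (isometryAct g x) x,
    hT.integral_zonalConv_sq_eq q (isometryAct g x) x]

theorem integral_zonalConv_blockKernel_sq (hT : IsIsotropicGRF P T) {A : ℕ → ℝ}
    (hA : IsAngularPowerSpectrum P T A) (j : ℕ) (x : Sphere2) :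
    ∫ ω, zonalConv (blockKernel j) (T ω) x ^ 2 ∂P =
      ∑ l ∈ Finset.Ico (2 ^ j) (2 ^ (j + 1)), (2 * l + 1) / (4 * Real.pi) * A l := by
  rw [hT.integral_zonalConv_sq_eq _ x northPole]
  have h1 : ∫ ω, zonalConv (blockKernel j) (T ω) northPole ^ 2 ∂P =
      ∫ ω, ∑ l ∈ Finset.Ico (2 ^ j) (2 ^ (j + 1)), ∑ m ∈ Finset.Ico (2 ^ j) (2 ^ (j + 1)),
        zonalConv (harmonicKernel l) (T ω) northPole *
          zonalConv (harmonicKernel m) (T ω) northPole ∂P := by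
    refine integral_congr_ae ?_
    filter_upwards [hT.ae_integrable] with ω hω
    rw [blockKernel, zonalConv_sum hω, sq, Finset.sum_mul_sum]
  have hint : ∀ l m : ℕ, Integrable (fun ω => zonalConv (harmonicKernel l) (T ω) northPole *
      zonalConv (harmonicKernel m) (T ω) northPole) P := fun l m =>
    (hT.memLp_two_zonalConv _ _).integrable_mul (hT.memLp_two_zonalConv _ _)
  have hpos : ∀ l ∈ Finset.Ico (2 ^ j) (2 ^ (j + 1)), 1 ≤ l := fun l hl =>
    Nat.one_le_two_pow.trans (Finset.mem_Ico.mp hl).1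
  rw [h1, integral_finsetSum _ fun l _ => integrable_finsetSum _ fun m _ => hint l m]
  refine Finset.sum_congr rfl fun l hl => ?_
  rw [integral_finsetSum _ fun m _ => hint l m, Finset.sum_congr rfl fun m hm =>
    integral_zonalConv_harmonicKernel_mul hA (hpos l hl) (hpos m hm), Finset.sum_ite_eq,
    if_pos hl]

/-- The variance of the blocks decays geometrically. -/
theorem integral_zonalConv_blockKernel_sq_le (hT : IsIsotropicGRF P T) {A : ℕ → ℝ}
    (hA : IsAngularPowerSpectrum P T A) {C α : ℝ} (hα : 0 ≤ α)
    (hdecay : ∀ l : ℕ, 1 ≤ l → A l ≤ C * (l : ℝ) ^ (-α)) (j : ℕ) (x : Sphere2) :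
    ∫ ω, zonalConv (blockKernel j) (T ω) x ^ 2 ∂P ≤ C * (((2 : ℝ) ^ (-((α - 2) / 2))) ^ j) ^ 2 := by
  have hC : 0 ≤ C := by simpa using (hA.nonneg 1).trans (hdecay 1 le_rfl)
  rw [hT.integral_zonalConv_blockKernel_sq hA]
  -- The block has 2^j terms, each weight (2l+1)/(4π) is at most 2^j, and A_l ≤ C 2^(-jα); the total
  -- is C 2^(-j(α-2)).
  have hterm : ∀ l ∈ Finset.Ico (2 ^ j) (2 ^ (j + 1)), (2 * l + 1) / (4 * Real.pi) * A l ≤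
      2 ^ j * (C * ((2 : ℝ) ^ j) ^ (-α)) := by
    intro l hl
    rw [Finset.mem_Ico] at hl
    have h1 : ((2 : ℝ) ^ j) ≤ l := by exact_mod_cast hl.1
    have h2 : (l : ℝ) + 1 ≤ 2 * 2 ^ j := by
      have : l + 1 ≤ 2 * 2 ^ j := by have := hl.2; rw [pow_succ] at this; omega
      exact_mod_cast this
    have hj : (1 : ℝ) ≤ 2 ^ j := one_le_pow₀ one_le_two
    have hA1 : A l ≤ C * ((2 : ℝ) ^ j) ^ (-α) := by
      refine (hdecay l (Nat.one_le_two_pow.trans hl.1)).trans ?_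
      gcongr C * ?_
      exact Real.rpow_le_rpow_of_nonpos (by positivity) h1 (by linarith)
    have h3 : (2 * l + 1) / (4 * Real.pi) ≤ (2 : ℝ) ^ j := by
      rw [div_le_iff₀ (by positivity)]
      nlinarith [Real.pi_gt_three]
    exact mul_le_mul h3 hA1 (hA.nonneg l) (by positivity)
  refine (Finset.sum_le_sum hterm).trans (le_of_eq ?_)
  rw [Finset.sum_const, Nat.card_Ico, show 2 ^ (j + 1) - 2 ^ j = 2 ^ j by rw [pow_succ]; omega,
    nsmul_eq_mul, ← Real.rpow_natCast 2 j, ← Real.rpow_mul zero_le_two,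
    ← Real.rpow_natCast (_ ^ (-((α - 2) / 2))) j, ← Real.rpow_mul zero_le_two,
    ← Real.rpow_natCast _ 2, ← Real.rpow_mul zero_le_two, mul_left_comm _ C, mul_left_comm _ C,
    Nat.cast_pow, Nat.cast_ofNat, ← Real.rpow_natCast, ← Real.rpow_add two_pos,
    ← Real.rpow_add two_pos]
  congr 2
  ring

theorem eLpNorm_two_zonalConv_blockKernel_le (hT : IsIsotropicGRF P T) {C ρ : ℝ} (hρ : 0 ≤ ρ)
    (hblock : ∀ (j : ℕ) (x : Sphere2),
      ∫ ω, zonalConv (blockKernel j) (T ω) x ^ 2 ∂P ≤ C * (ρ ^ j) ^ 2) (j : ℕ) (x : Sphere2) :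
    eLpNorm (fun ω => zonalConv (blockKernel j) (T ω) x) 2 P ≤ ENNReal.ofReal (√C * ρ ^ j) := by
  rw [(hT.memLp_two_zonalConv _ x).eLpNorm_two_eq_sqrt]
  refine ENNReal.ofReal_le_ofReal ((Real.sqrt_le_sqrt (hblock j x)).trans (le_of_eq ?_))
  rw [Real.sqrt_mul' _ (sq_nonneg _), Real.sqrt_sq (by positivity)]

/-- Equivalence of Gaussian moments; the point is that c, namely √C times a factor depending on p
alone, serves all j and x. -/
theorem lintegral_enorm_zonalConv_blockKernel_pow_le (hT : IsIsotropicGRF P T) {C ρ : ℝ}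
    (hρ : 0 ≤ ρ) (hblock : ∀ (j : ℕ) (x : Sphere2),
      ∫ ω, zonalConv (blockKernel j) (T ω) x ^ 2 ∂P ≤ C * (ρ ^ j) ^ 2) {p : ℕ} (hp : 1 ≤ p) :
    ∃ c : ℝ, 0 ≤ c ∧ ∀ (j : ℕ) (x : Sphere2),
      ∫⁻ ω, ‖zonalConv (blockKernel j) (T ω) x‖ₑ ^ p ∂P ≤ ENNReal.ofReal ((c * ρ ^ j) ^ p) := by
  set c := 1 + eLpNorm id p (gaussianReal 0 1) with hc
  have hctop : c ≠ ⊤ := by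
    refine ENNReal.add_ne_top.mpr ⟨ENNReal.one_ne_top, ?_⟩
    exact (memLp_id_gaussianReal' p (ENNReal.natCast_ne_top p)).2.ne
  refine ⟨c.toReal * √C, by positivity, fun j x => ?_⟩
  have h1 : eLpNorm (fun ω => zonalConv (blockKernel j) (T ω) x) p P ≤
      ENNReal.ofReal (c.toReal * √C * ρ ^ j) := by
    refine (hT.eLpNorm_integral_mul_le (continuous_eval_cosDist _ x)
      (by exact_mod_cast hp)).trans ?_
    rw [mul_assoc, ENNReal.ofReal_mul ENNReal.toReal_nonneg, ENNReal.ofReal_toReal hctop]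
    gcongr
    exact hT.eLpNorm_two_zonalConv_blockKernel_le hρ hblock j x
  have hp0 : p ≠ 0 := by omega
  have h2 := eLpNorm_nnreal_pow_eq_lintegral (μ := P) (p := p) (by exact_mod_cast hp0)
    (f := fun ω => zonalConv (blockKernel j) (T ω) x)
  simp only [NNReal.coe_natCast, ENNReal.rpow_natCast, ENNReal.coe_natCast] at h2
  rw [← h2, ENNReal.ofReal_pow (by positivity)]
  gcongr

/-- Almost surely, the blocks decay uniformly at every geometric rate above `ρ`. -/
theorem ae_exists_abs_zonalConv_blockKernel_le (hT : IsIsotropicGRF P T) {C ρ : ℝ} (hρ : 0 < ρ)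
    (hblock : ∀ (j : ℕ) (x : Sphere2),
      ∫ ω, zonalConv (blockKernel j) (T ω) x ^ 2 ∂P ≤ C * (ρ ^ j) ^ 2) {r : ℝ} (hr : ρ < r) :
    ∀ᵐ ω ∂P, ∃ K, ∀ (j : ℕ) (x : Sphere2), |zonalConv (blockKernel j) (T ω) x| ≤ K * r ^ j := by
  have hr0 : 0 < r := hρ.trans hr
  -- The Nikolskii inequality costs (2^(j+1))³, that is 8^j up to a constant, and (ρ/r)^p < 1/8
  -- beats it.
  obtain ⟨p, hp⟩ := exists_pow_lt_of_lt_one (show (0 : ℝ) < 1 / 8 by norm_num)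
    ((div_lt_one hr0).mpr hr)
  have hp1 : 1 ≤ p := by
    by_contra! h
    have : p = 0 := by omega
    norm_num [this] at hp
  obtain ⟨c, hc0, hc⟩ := hT.lintegral_enorm_zonalConv_blockKernel_pow_le hρ.le hblock hp1
  obtain ⟨b, hb0, hb⟩ := exists_abs_zonalConv_pow_le
  have hmeas : ∀ j, Measurable fun z : Ω × Sphere2 => ‖zonalConv (blockKernel j) (T z.1) z.2‖ₑ ^ p :=
    fun j => (hT.measurable_zonalConv _).enorm.pow_const p
  -- With this weight the expectations are summable, of order (8 (ρ/r)^p)^j, while a bound on F_j is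
  -- what Nikolskii converts into sup |Δ_j T|^p ≤ const · r^(jp).
  set F : ℕ → Ω → ENNReal := fun j ω => ENNReal.ofReal ((8 / r ^ p) ^ j) *
    ∫⁻ x, ‖zonalConv (blockKernel j) (T ω) x‖ₑ ^ p ∂sphereMeasure with hF
  have hFm : ∀ j, Measurable (F j) := fun j => ((hmeas j).lintegral_prod_right').const_mul _
  have hFle : ∀ j, ∫⁻ ω, F j ω ∂P ≤ ENNReal.ofReal (c ^ p) * sphereMeasure Set.univ *
      ENNReal.ofReal (8 * (ρ / r) ^ p) ^ j := by
    intro j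
    simp only [hF]
    rw [lintegral_const_mul _ (hmeas j).lintegral_prod_right', lintegral_lintegral_swap
      (hmeas j).aemeasurable]
    calc ENNReal.ofReal ((8 / r ^ p) ^ j) *
          ∫⁻ x, ∫⁻ ω, ‖zonalConv (blockKernel j) (T ω) x‖ₑ ^ p ∂P ∂sphereMeasure
        ≤ ENNReal.ofReal ((8 / r ^ p) ^ j) *
          ∫⁻ _, ENNReal.ofReal ((c * ρ ^ j) ^ p) ∂sphereMeasure := by
          gcongr with x
          exact hc j x
      _ = _ := by
          rw [lintegral_const, ← mul_assoc, ← ENNReal.ofReal_mul (by positivity),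
            ← ENNReal.ofReal_pow (by positivity), mul_right_comm,
            ← ENNReal.ofReal_mul (by positivity)]
          congr 2
          rw [mul_pow, mul_pow, div_pow, div_pow, div_pow, ← pow_mul ρ, mul_comm j p, pow_mul ρ]
          field_simp
  have hsum : ∫⁻ ω, ∑' j, F j ω ∂P ≠ ⊤ := by
    rw [lintegral_tsum fun j => (hFm j).aemeasurable]
    refine ne_top_of_le_ne_top ?_ (ENNReal.tsum_le_tsum hFle)
    rw [ENNReal.tsum_mul_left]
    refine ENNReal.mul_ne_top (ENNReal.mul_ne_top ENNReal.ofReal_ne_top (measure_ne_top _ _)) ?_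
    rw [ENNReal.tsum_geometric]
    refine ENNReal.inv_ne_top.mpr (tsub_pos_of_lt ?_).ne'
    rw [ENNReal.ofReal_lt_one]
    linarith
  filter_upwards [ae_lt_top (Measurable.tsum hFm) hsum, hT.ae_integrable] with ω hω hint
  set K := (∑' j, F j ω).toReal with hK
  -- The maximum with 1 gives K' ≤ K'^p, so that p-th roots can be taken.
  set K' := max 1 (b * 8 * 2 ^ p * K) with hK'
  refine ⟨K', fun j x => ?_⟩
  have hcont := continuous_zonalConv (blockKernel j) hint
  have hnn : 0 ≤ ∫ y, |zonalConv (blockKernel j) (T ω) y| ^ p ∂sphereMeasure :=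
    integral_nonneg fun y => by positivity
  have hj : (8 / r ^ p) ^ j * ∫ y, |zonalConv (blockKernel j) (T ω) y| ^ p ∂sphereMeasure ≤ K := by
    have h1 : F j ω = ENNReal.ofReal ((8 / r ^ p) ^ j *
        ∫ y, |zonalConv (blockKernel j) (T ω) y| ^ p ∂sphereMeasure) := by
      rw [ENNReal.ofReal_mul (by positivity), ofReal_integral_eq_lintegral_ofReal]
      · simp only [hF]
        congr 1
        refine lintegral_congr fun y => ?_
        rw [ENNReal.ofReal_pow (abs_nonneg _), Real.enorm_eq_ofReal_abs]
      · simpa using integrable_mul_of_continuous (integrable_const (1 : ℝ)) (hcont.abs.pow p)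
      · exact Filter.Eventually.of_forall fun y => by positivity
    rw [hK, ← ENNReal.ofReal_le_iff_le_toReal hω.ne, ← h1]
    exact ENNReal.le_tsum j
  have hnik := hb (blockKernel j) (2 ^ (j + 1)) Nat.one_le_two_pow (natDegree_blockKernel_le j)
    (T ω) hint p x
  have hpow : |zonalConv (blockKernel j) (T ω) x| ^ p ≤ (K' * r ^ j) ^ p := by
    calc |zonalConv (blockKernel j) (T ω) x| ^ p
        ≤ b * ((2 ^ (j + 1) : ℕ) : ℝ) ^ 3 * 2 ^ p *
          ∫ y, |zonalConv (blockKernel j) (T ω) y| ^ p ∂sphereMeasure := hnik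
      _ = b * 8 * 2 ^ p * ((8 / r ^ p) ^ j *
          ∫ y, |zonalConv (blockKernel j) (T ω) y| ^ p ∂sphereMeasure) * (r ^ j) ^ p := by
          have h8 : ((2 ^ (j + 1) : ℕ) : ℝ) ^ 3 = 8 * 8 ^ j := by
            push_cast
            rw [← pow_mul, mul_comm (j + 1) 3, pow_mul, pow_succ]
            norm_num
            ring
          rw [h8, div_pow, ← pow_mul r, ← pow_mul r, mul_comm j p]
          field_simp
      _ ≤ b * 8 * 2 ^ p * K * (r ^ j) ^ p := by gcongr
      _ ≤ K' * (r ^ j) ^ p := by gcongr; exact le_max_right _ _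
      _ ≤ K' ^ p * (r ^ j) ^ p := by
          gcongr
          exact le_self_pow₀ (le_max_left _ _) (by omega)
      _ = _ := (mul_pow _ _ _).symm
  exact (pow_le_pow_iff_left₀ (abs_nonneg _) (by positivity) (by omega)).mp hpow

end IsIsotropicGRF

/-! ### Littlewood–Paley series -/

/-- The Littlewood–Paley series of `f`. -/
noncomputable def littlewoodPaleySum (f : Sphere2 → ℝ) (x : Sphere2) : ℝ :=
  zonalConv (harmonicKernel 0) f x + ∑' j, zonalConv (blockKernel j) f x

theorem zonalConv_partialKernel {f : Sphere2 → ℝ} (hf : Integrable f sphereMeasure) (J : ℕ)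
    (x : Sphere2) : zonalConv (partialKernel J) f x = zonalConv (harmonicKernel 0) f x +
      ∑ j ∈ Finset.range J, zonalConv (blockKernel j) f x := by
  rw [partialKernel, zonalConv_add hf, zonalConv_sum hf]

theorem zonalConv_harmonicKernel_zero_eq (f : Sphere2 → ℝ) (x y : Sphere2) :
    zonalConv (harmonicKernel 0) f x = zonalConv (harmonicKernel 0) f y := by
  rw [Polynomial.eq_C_of_natDegree_le_zero (natDegree_harmonicKernel_le 0)]
  simp [zonalConv]

section Decay

variable {f : Sphere2 → ℝ} {K r : ℝ}

theorem summable_zonalConv_blockKernel (hr0 : 0 ≤ r) (hr1 : r < 1)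
    (hK : ∀ (j : ℕ) (x : Sphere2), |zonalConv (blockKernel j) f x| ≤ K * r ^ j) (x : Sphere2) :
    Summable fun j => zonalConv (blockKernel j) f x :=
  ((summable_geometric_of_lt_one hr0 hr1).mul_left K).of_norm_bounded fun j => hK j x

theorem tendsto_zonalConv_partialKernel (hf : Integrable f sphereMeasure) (hr0 : 0 ≤ r)
    (hr1 : r < 1)
    (hK : ∀ (j : ℕ) (x : Sphere2), |zonalConv (blockKernel j) f x| ≤ K * r ^ j) (x : Sphere2) :
    Filter.Tendsto (fun J => zonalConv (partialKernel J) f x) Filter.atTop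
      (nhds (littlewoodPaleySum f x)) := by
  simp only [zonalConv_partialKernel hf]
  exact (summable_zonalConv_blockKernel hr0 hr1 hK x).hasSum.tendsto_sum_nat.const_add _

theorem continuous_littlewoodPaleySum (hf : Integrable f sphereMeasure) (hr0 : 0 ≤ r)
    (hr1 : r < 1)
    (hK : ∀ (j : ℕ) (x : Sphere2), |zonalConv (blockKernel j) f x| ≤ K * r ^ j) :
    Continuous (littlewoodPaleySum f) :=
  (continuous_zonalConv _ hf).add (continuous_tsum (fun _ => continuous_zonalConv _ hf)
    ((summable_geometric_of_lt_one hr0 hr1).mul_left K) fun j x => hK j x)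

theorem zonalConv_zonalConv (hf : Integrable f sphereMeasure) (p q : Polynomial ℝ)
    (x : Sphere2) : zonalConv p (zonalConv q f) x =
      ∫ z, f z * zonalConv q (fun y => p.eval (cosDist x y)) z ∂sphereMeasure := by
  have hc : Continuous fun u : Sphere2 × Sphere2 =>
      q.eval (cosDist u.1 u.2) * p.eval (cosDist x u.1) :=
    (q.continuous.comp continuous_cosDist).mul
      (p.continuous.comp (continuous_cosDist.comp (continuous_const.prodMk continuous_fst)))
  obtain ⟨M, hM⟩ := isCompact_univ.exists_bound_of_continuousOn hc.continuousOn
  have hint : Integrable (fun u : Sphere2 × Sphere2 => f u.2 *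
      (q.eval (cosDist u.1 u.2) * p.eval (cosDist x u.1)))
      (sphereMeasure.prod sphereMeasure) :=
    (hf.comp_snd sphereMeasure).mul_bdd hc.aestronglyMeasurable
      (Filter.Eventually.of_forall fun u => hM u trivial)
  simp only [zonalConv, ← integral_mul_const, ← integral_const_mul]
  rw [integral_integral_swap]
  · refine integral_congr_ae (Filter.Eventually.of_forall fun z => ?_)
    refine integral_congr_ae (Filter.Eventually.of_forall fun y => ?_)
    simp only [cosDist_comm z y]
    ring
  · refine hint.congr (Filter.Eventually.of_forall fun u => ?_)
    simp only [Function.uncurry]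
    ring

/-- For l < 2^J the kernel contains (2l+1)/(4π) P_l, whose convolution with P_l is P_l; the other
degrees are annihilated. -/
theorem zonalConv_legendrePoly_zonalConv_partialKernel (hf : Integrable f sphereMeasure)
    {l J : ℕ} (hl : l < 2 ^ J) (x : Sphere2) :
    zonalConv (legendrePoly l) (zonalConv (partialKernel J) f) x =
      zonalConv (legendrePoly l) f x := by
  rw [zonalConv_zonalConv hf, zonalConv]
  refine integral_congr_ae (Filter.Eventually.of_forall fun z => ?_)
  simp only
  congr 1
  rw [partialKernel_eq_sum, zonalConv_sum (integrable_eval_cosDist _ x),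
    Finset.sum_eq_single_of_mem l (Finset.mem_range.mpr hl)]
  · rw [harmonicKernel, zonalConv_C_mul, zonalConv_legendrePoly_self]
    have := Real.pi_pos
    field_simp
  · intro m _ hm
    rw [harmonicKernel, zonalConv_C_mul, zonalConv_legendrePoly_of_ne hm.symm, mul_zero]

/-- The partial sums are uniformly bounded, so dominated convergence passes their Legendre
convolutions to the limit; these agree with those of f, and completeness concludes. -/
theorem ae_eq_littlewoodPaleySum (hf : Integrable f sphereMeasure) (hr0 : 0 ≤ r) (hr1 : r < 1)
    (hK : ∀ (j : ℕ) (x : Sphere2), |zonalConv (blockKernel j) f x| ≤ K * r ^ j) :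
    f =ᵐ[sphereMeasure] littlewoodPaleySum f := by
  have hcont := continuous_littlewoodPaleySum hf hr0 hr1 hK
  have hLint : Integrable (littlewoodPaleySum f) sphereMeasure := by
    simpa using integrable_mul_of_continuous (integrable_const (1 : ℝ)) hcont
  have hlim := tendsto_zonalConv_partialKernel hf hr0 hr1 hK
  obtain ⟨B, hB⟩ : ∃ B, ∀ J y, |zonalConv (partialKernel J) f y| ≤ B := by
    refine ⟨|zonalConv (harmonicKernel 0) f northPole| + ∑' j, |K| * r ^ j, fun J y => ?_⟩
    have hs := (summable_geometric_of_lt_one hr0 hr1).mul_left |K|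
    rw [zonalConv_partialKernel hf, zonalConv_harmonicKernel_zero_eq f y northPole]
    refine (abs_add_le _ _).trans (add_le_add le_rfl ?_)
    refine (Finset.abs_sum_le_sum_abs _ _).trans ?_
    refine le_trans (Finset.sum_le_sum fun j _ => (hK j y).trans ?_)
      (hs.sum_le_tsum _ fun j _ => by positivity)
    gcongr
    exact le_abs_self K
  have key : ∀ l x, zonalConv (legendrePoly l) (littlewoodPaleySum f) x =
      zonalConv (legendrePoly l) f x := by
    intro l x
    obtain ⟨M, hM0, hM⟩ := (legendrePoly l).exists_abs_eval_cosDist_le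
    have h1 : Filter.Tendsto (fun J => zonalConv (legendrePoly l) (zonalConv (partialKernel J) f) x)
        Filter.atTop (nhds (zonalConv (legendrePoly l) (littlewoodPaleySum f) x)) := by
      refine tendsto_integral_of_dominated_convergence (fun _ => B * M) (fun J =>
        ((continuous_zonalConv _ hf).mul (continuous_eval_cosDist _ x)).aestronglyMeasurable)
        (integrable_const _) (fun J => Filter.Eventually.of_forall fun y => ?_)
        (Filter.Eventually.of_forall fun y => (hlim y).mul_const _)
      rw [Real.norm_eq_abs, abs_mul]
      exact mul_le_mul (hB J y) (hM x y) (abs_nonneg _) ((abs_nonneg _).trans (hB J y))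
    refine tendsto_nhds_unique h1 (tendsto_const_nhds.congr' ?_)
    filter_upwards [Filter.eventually_ge_atTop l] with J hJ
    exact (zonalConv_legendrePoly_zonalConv_partialKernel hf
      (hJ.trans_lt Nat.lt_two_pow_self) x).symm
  have h0 := ae_eq_zero_of_zonalConv_legendrePoly (hf.sub hLint) fun l x => by
    have h2 : zonalConv (legendrePoly l) (f - littlewoodPaleySum f) x =
        zonalConv (legendrePoly l) f x -
          zonalConv (legendrePoly l) (littlewoodPaleySum f) x := by
      simp only [zonalConv, Pi.sub_apply, sub_mul]
      exact integral_sub (integrable_mul_of_continuous hf (continuous_eval_cosDist _ x))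
        (integrable_mul_of_continuous hLint (continuous_eval_cosDist _ x))
    rw [h2, key, sub_self]
  filter_upwards [h0] with y hy
  exact sub_eq_zero.mp hy

/-- Decay of the blocks implies Hölder continuity. -/
theorem isHoelderSphere_littlewoodPaleySum (hf : Integrable f sphereMeasure) (hr0 : 0 ≤ r)
    (hr1 : r < 1)
    (hK : ∀ (j : ℕ) (x : Sphere2), |zonalConv (blockKernel j) f x| ≤ K * r ^ j) {γ : ℝ}
    (hγ0 : 0 < γ) (hγ1 : γ ≤ 1) (hγr : 2 ^ γ * r < 1) :
    IsHoelderSphere γ (littlewoodPaleySum f) := by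
  have hK0 : 0 ≤ K := by simpa using (abs_nonneg _).trans (hK 0 northPole)
  have hs : Summable fun j : ℕ => (2 ^ γ * r) ^ j :=
    summable_geometric_of_lt_one (by positivity) hγr
  refine ⟨18 * K * ∑' j : ℕ, (2 ^ γ * r) ^ j, fun x y => ?_⟩
  set d := geodesicDist x y with hd
  have hd0 : 0 ≤ d := geodesicDist_nonneg x y
  have hblock : ∀ j, |zonalConv (blockKernel j) f x - zonalConv (blockKernel j) f y| ≤
      18 * K * (2 ^ γ * r) ^ j * d ^ γ := by
    intro j
    have hmul : (2 ^ γ * r) ^ j * d ^ γ = r ^ j * (2 ^ j * d) ^ γ := by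
      rw [Real.mul_rpow (by positivity) hd0, mul_pow, ← Real.rpow_natCast (2 ^ γ),
        ← Real.rpow_mul zero_le_two, mul_comm γ, Real.rpow_mul zero_le_two, Real.rpow_natCast]
      ring
    have hrj : 0 ≤ K * r ^ j := by positivity
    rw [mul_assoc, hmul, mul_assoc 18, ← mul_assoc K]
    -- At scales coarser than d Bernstein gives 9 · 2^(j+1) K r^j d, and t ≤ t^γ for t = 2^j d ≤ 1.
    -- At finer scales the crude bound 2 K r^j suffices, as t^γ ≥ 1.
    rcases le_total (2 ^ j * d) 1 with h | h
    · have h1 := abs_zonalConv_sub_le Nat.one_le_two_pow (natDegree_blockKernel_le j) hf (hK j) x y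
      have h2 : 2 ^ j * d ≤ (2 ^ j * d) ^ γ := by
        conv_lhs => rw [← Real.rpow_one (2 ^ j * d)]
        exact Real.rpow_le_rpow_of_exponent_ge_of_imp (by positivity) h hγ1 (by
          intro _ h; linarith)
      refine h1.trans ?_
      push_cast
      rw [pow_succ]
      nlinarith [mul_le_mul_of_nonneg_left h2 hrj]
    · have h1 := (abs_sub (zonalConv (blockKernel j) f x) (zonalConv (blockKernel j) f y)).trans
        (add_le_add (hK j x) (hK j y))
      have h2 : 1 ≤ (2 ^ j * d) ^ γ := Real.one_le_rpow h hγ0.le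
      nlinarith [mul_le_mul_of_nonneg_left h2 hrj]
  have hsx := summable_zonalConv_blockKernel hr0 hr1 hK x
  have hsy := summable_zonalConv_blockKernel hr0 hr1 hK y
  have hsb : Summable fun j : ℕ => 18 * K * (2 ^ γ * r) ^ j * d ^ γ :=
    (hs.mul_left _).mul_right _
  rw [littlewoodPaleySum, littlewoodPaleySum, zonalConv_harmonicKernel_zero_eq f x y,
    add_sub_add_left_eq_sub, ← hsx.tsum_sub hsy, ← tsum_mul_left, ← tsum_mul_right]
  exact tsum_of_norm_bounded hsb.hasSum fun j => (Real.norm_eq_abs _).trans_le (hblock j)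

end Decay

/-- The exponential of a bounded Hölder continuous function is Hölder continuous. -/
theorem IsHoelderSphere.exp {f : Sphere2 → ℝ} {γ : ℝ} (hf : IsHoelderSphere γ f)
    (hc : Continuous f) : IsHoelderSphere γ fun x => Real.exp (f x) := by
  obtain ⟨K, hK⟩ := hf
  obtain ⟨R, hR⟩ := isCompact_univ.exists_bound_of_continuousOn hc.continuousOn
  refine ⟨Real.exp R * K, fun x y => ?_⟩
  have key : |Real.exp (f x) - Real.exp (f y)| ≤ Real.exp R * |f x - f y| := by
    have := Convex.norm_image_sub_le_of_norm_deriv_le (s := Set.Iic R) (f := Real.exp)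
      (C := Real.exp R) (fun t _ => Real.differentiableAt_exp) (fun t ht => by
        rw [Real.deriv_exp, Real.norm_of_nonneg (Real.exp_pos t).le]
        exact Real.exp_le_exp.mpr ht) (convex_Iic R)
      (show f y ∈ Set.Iic R from (le_abs_self _).trans (hR y trivial))
      (show f x ∈ Set.Iic R from (le_abs_self _).trans (hR x trivial))
    exact this
  rw [mul_assoc]
  exact key.trans (mul_le_mul_of_nonneg_left (hK x y) (Real.exp_pos R).le)

theorem isHoelderSphere_const (c γ : ℝ) : IsHoelderSphere γ fun _ => c :=
  ⟨0, fun x y => by simp⟩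

/-! ### The modification -/

namespace IsIsotropicGRF

variable {Ω : Type*} [MeasurableSpace Ω] {P : Measure Ω} {T : Ω → Sphere2 → ℝ}

theorem measurable_littlewoodPaleySum (hT : IsIsotropicGRF P T) :
    Measurable fun z : Ω × Sphere2 => littlewoodPaleySum (T z.1) z.2 :=
  (hT.measurable_zonalConv _).add (Measurable.tsum fun _ => hT.measurable_zonalConv _)

variable [IsProbabilityMeasure P]

theorem eLpNorm_sub_zonalConv_partialKernel_eq (hT : IsIsotropicGRF P T) (J : ℕ)
    (x z : Sphere2) :
    eLpNorm (fun ω => T ω x - zonalConv (partialKernel J) (T ω) x) 2 P =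
      eLpNorm (fun ω => T ω z - zonalConv (partialKernel J) (T ω) z) 2 P := by
  have h : ∀ y, MemLp (fun ω => T ω y - zonalConv (partialKernel J) (T ω) y) 2 P := fun y =>
    (hT.memLp_two y).sub (hT.memLp_two_zonalConv _ y)
  rw [(h x).eLpNorm_two_eq_sqrt, (h z).eLpNorm_two_eq_sqrt,
    hT.integral_sub_zonalConv_sq_eq _ x z]

theorem eLpNorm_zonalConv_partialKernel_sub_le (hT : IsIsotropicGRF P T) {C ρ : ℝ} (hρ : 0 ≤ ρ)
    (hρ1 : ρ < 1) (hblock : ∀ (j : ℕ) (x : Sphere2),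
      ∫ ω, zonalConv (blockKernel j) (T ω) x ^ 2 ∂P ≤ C * (ρ ^ j) ^ 2) (J n : ℕ) (x : Sphere2) :
    eLpNorm (fun ω => zonalConv (partialKernel (J + n)) (T ω) x -
      zonalConv (partialKernel J) (T ω) x) 2 P ≤ ENNReal.ofReal (√C * ρ ^ J / (1 - ρ)) := by
  have h1 : (fun ω => zonalConv (partialKernel (J + n)) (T ω) x -
      zonalConv (partialKernel J) (T ω) x) =ᵐ[P]
      ∑ i ∈ Finset.range n, fun ω => zonalConv (blockKernel (J + i)) (T ω) x := by
    filter_upwards [hT.ae_integrable] with ω hω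
    rw [zonalConv_partialKernel hω, zonalConv_partialKernel hω, Finset.sum_apply,
      Finset.sum_range_add]
    ring
  rw [eLpNorm_congr_ae h1]
  refine (eLpNorm_sum_le (fun i _ => (hT.memLp_two_zonalConv _ x).aestronglyMeasurable)
    one_le_two).trans ?_
  refine (Finset.sum_le_sum fun i _ =>
    hT.eLpNorm_two_zonalConv_blockKernel_le hρ hblock (J + i) x).trans ?_
  rw [← ENNReal.ofReal_sum_of_nonneg fun i _ => by positivity]
  refine ENNReal.ofReal_le_ofReal ?_
  have h2 : ∀ i ∈ Finset.range n, √C * ρ ^ (J + i) = √C * ρ ^ J * ρ ^ i := fun i _ => by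
    rw [pow_add]; ring
  rw [Finset.sum_congr rfl h2, ← Finset.mul_sum, div_eq_mul_inv,
    ← tsum_geometric_of_lt_one hρ hρ1]
  gcongr
  exact (summable_geometric_of_lt_one hρ hρ1).sum_le_tsum _ fun i _ => by positivity

/-- Under geometric decay of the blocks, the Littlewood–Paley series is a modification of the
field. -/
theorem ae_eq_littlewoodPaleySum (hT : IsIsotropicGRF P T) {C ρ : ℝ} (hρ : 0 < ρ)
    (hρ1 : ρ < 1) (hblock : ∀ (j : ℕ) (x : Sphere2),
      ∫ ω, zonalConv (blockKernel j) (T ω) x ^ 2 ∂P ≤ C * (ρ ^ j) ^ 2) (x : Sphere2) :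
    ∀ᵐ ω ∂P, T ω x = littlewoodPaleySum (T ω) x := by
  obtain ⟨r, hρr, hr1⟩ := exists_between hρ1
  have hr0 : 0 ≤ r := (hρ.trans hρr).le
  have hdecay := hT.ae_exists_abs_zonalConv_blockKernel_le hρ hblock hρr
  have hlim : ∀ x, ∀ᵐ ω ∂P, Filter.Tendsto (fun J => zonalConv (partialKernel J) (T ω) x)
      Filter.atTop (nhds (littlewoodPaleySum (T ω) x)) := by
    intro x
    filter_upwards [hdecay, hT.ae_integrable] with ω ⟨K, hK⟩ hω
    exact tendsto_zonalConv_partialKernel hω hr0 hr1 hK x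
  -- Almost every path agrees with its series σ-almost everywhere; exchanging the quantifiers by
  -- Fubini provides one point with almost sure equality.
  obtain ⟨z, hz⟩ : ∃ z, ∀ᵐ ω ∂P, T ω z = littlewoodPaleySum (T ω) z := by
    have h1 : ∀ᵐ ω ∂P, ∀ᵐ y ∂sphereMeasure, T ω y = littlewoodPaleySum (T ω) y := by
      filter_upwards [hdecay, hT.ae_integrable] with ω ⟨K, hK⟩ hω
      exact _root_.ae_eq_littlewoodPaleySum hω hr0 hr1 hK
    have h2 : MeasurableSet {u : Ω × Sphere2 | T u.1 u.2 = littlewoodPaleySum (T u.1) u.2} :=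
      measurableSet_eq_fun hT.isRandomField hT.measurable_littlewoodPaleySum
    rw [Measure.ae_ae_comm h2] at h1
    have : NeZero sphereMeasure := ⟨by rw [sphereMeasure]; exact Measure.toSphere_ne_zero _⟩
    exact h1.exists
  have hmeas : ∀ J x, AEStronglyMeasurable (fun ω => zonalConv (partialKernel J) (T ω) x) P :=
    fun J x => (hT.memLp_two_zonalConv _ x).aestronglyMeasurable
  -- At z the field is the almost sure limit of the partial sums, so Fatou turns the L² bound on
  -- their differences into a bound on the error.
  have hz' : ∀ J, eLpNorm (fun ω => T ω z - zonalConv (partialKernel J) (T ω) z) 2 P ≤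
      ENNReal.ofReal (√C * ρ ^ J / (1 - ρ)) := by
    intro J
    refine (Lp.eLpNorm_lim_le_liminf_eLpNorm
      (f := fun n ω => zonalConv (partialKernel (J + n)) (T ω) z -
        zonalConv (partialKernel J) (T ω) z) (fun n => (hmeas _ z).sub (hmeas _ z)) _ ?_).trans ?_
    · filter_upwards [hlim z, hz] with ω h1 h2
      rw [h2]
      refine Filter.Tendsto.sub_const ?_ _
      simp only [add_comm J]
      exact (Filter.tendsto_add_atTop_iff_nat J).mpr h1
    · refine Filter.liminf_le_of_le (by isBoundedDefault) fun b hb => ?_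
      obtain ⟨n, hn⟩ := hb.exists
      exact hn.trans (hT.eLpNorm_zonalConv_partialKernel_sub_le hρ.le hρ1 hblock J n z)
  -- The L² error is the same at x as at z, hence tends to 0.
  have hconv : Filter.Tendsto (fun J => eLpNorm ((fun ω => zonalConv (partialKernel J) (T ω) x) -
      fun ω => T ω x) 2 P) Filter.atTop (nhds 0) := by
    have h0 : Filter.Tendsto (fun J : ℕ => ENNReal.ofReal (√C * ρ ^ J / (1 - ρ))) Filter.atTop
        (nhds 0) := by
      rw [← ENNReal.ofReal_zero]
      refine ENNReal.tendsto_ofReal ?_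
      simpa using ((tendsto_pow_atTop_nhds_zero_of_lt_one hρ.le hρ1).const_mul √C).div_const (1 - ρ)
    refine tendsto_of_tendsto_of_tendsto_of_le_of_le tendsto_const_nhds h0 (fun _ => zero_le)
      fun J => ?_
    simp only
    rw [eLpNorm_sub_comm]
    exact (hT.eLpNorm_sub_zonalConv_partialKernel_eq J x z).trans_le (hz' J)
  exact tendstoInMeasure_ae_unique
    (tendstoInMeasure_of_tendsto_eLpNorm two_ne_zero (fun J => hmeas J x)
      (hT.memLp_two x).aestronglyMeasurable hconv)
    (tendstoInMeasure_of_tendsto_ae (fun J => hmeas J x) (hlim x))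

end IsIsotropicGRF

/-! ### Proof of the main theorem -/

theorem mainTheorem9 {Ω : Type*} [MeasurableSpace Ω] (P : Measure Ω) [IsProbabilityMeasure P]
    (T : Ω → Sphere2 → ℝ) (hT : IsIsotropicGRF P T)
    (A : ℕ → ℝ) (hA : IsAngularPowerSpectrum P T A)
    (C α : ℝ) (hα : 2 < α) (hdecay : ∀ l : ℕ, 1 ≤ l → A l ≤ C * (l : ℝ) ^ (-α)) :
    ∃ S : Ω → Sphere2 → ℝ,
      IsModification P S (fun ω x => Real.exp (T ω x)) ∧
      ∀ (ω : Ω) (γ : ℝ), 0 < γ → γ < (α - 2) / 2 → γ ≤ 1 → IsHoelderSphere γ (S ω) := by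
  classical
  set ρ : ℝ := 2 ^ (-((α - 2) / 2)) with hρdef
  have hρ : 0 < ρ := by positivity
  have hρ1 : ρ < 1 := Real.rpow_lt_one_of_one_lt_of_neg one_lt_two (by linarith)
  have hblock := hT.integral_zonalConv_blockKernel_sq_le hA (by linarith) hdecay
  rw [← hρdef] at hblock
  -- Countably many rates decreasing to ρ, so that one null set serves every exponent γ.
  obtain ⟨r, -, hrmem, hrlim⟩ := exists_seq_strictAnti_tendsto' hρ1
  have hgood : ∀ᵐ ω ∂P, Integrable (T ω) sphereMeasure ∧ ∀ n, ∃ K, ∀ (j : ℕ) (x : Sphere2),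
      |zonalConv (blockKernel j) (T ω) x| ≤ K * r n ^ j :=
    hT.ae_integrable.and (ae_all_iff.mpr fun n =>
      hT.ae_exists_abs_zonalConv_blockKernel_le hρ hblock (hrmem n).1)
  -- A measurable null set containing the bad paths: replacing the field by the constant 1 on it
  -- keeps joint measurability and makes every path regular.
  obtain ⟨N, hN, hNm, hN0⟩ := exists_measurable_superset_of_null (ae_iff.mp hgood)
  have hgoodN : ∀ ω, ω ∉ N → Integrable (T ω) sphereMeasure ∧ ∀ n, ∃ K, ∀ (j : ℕ) (x : Sphere2),
      |zonalConv (blockKernel j) (T ω) x| ≤ K * r n ^ j := fun ω hω => by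
    by_contra h
    exact hω (hN h)
  refine ⟨fun ω x => if ω ∈ N then 1 else Real.exp (littlewoodPaleySum (T ω) x),
    ⟨?_, fun x => ?_⟩, fun ω γ hγ0 hγ hγ1 => ?_⟩
  · exact Measurable.ite (measurable_fst hNm) measurable_const
      (Real.measurable_exp.comp hT.measurable_littlewoodPaleySum)
  · filter_upwards [hT.ae_eq_littlewoodPaleySum hρ hρ1 hblock x, 
      measure_eq_zero_iff_ae_notMem.mp hN0] with ω h1 h2
    rw [if_neg h2, h1]
  · by_cases hω : ω ∈ N
    · simp only [hω, if_true]
      exact isHoelderSphere_const 1 γ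
    · simp only [hω, if_false]
      obtain ⟨hint, hall⟩ := hgoodN ω hω
      -- This is the condition γ < (α-2)/2; being open, it also holds with ρ replaced by r_n for
      -- some n.
      have hlt : 2 ^ γ * ρ < 1 := by
        rw [hρdef, ← Real.rpow_add two_pos]
        exact Real.rpow_lt_one_of_one_lt_of_neg one_lt_two (by linarith)
      obtain ⟨n, hn⟩ := ((hrlim.const_mul ((2 : ℝ) ^ γ)).eventually_lt_const hlt).exists
      obtain ⟨K, hK⟩ := hall n
      have hr0 : 0 ≤ r n := (hρ.trans (hrmem n).1).le
      exact (isHoelderSphere_littlewoodPaleySum hint hr0 (hrmem n).2 hK hγ0 hγ1 hn).exp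
        (continuous_littlewoodPaleySum hint hr0 (hrmem n).2 hK)
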